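/- Let $X\subseteq\mathbb R^d$ be a closed subset with the restriction of the Euclidean metric, let $H$ be a complex Hilbert space and let $\varrho\colon C_0(X)\to\mathbb B(H)$ be a nondegenerate $*$-representation. Let $\bar\varrho\colon C_b(X)\to\mathbb B(H)$ be its canonical extension to the multiplier algebra (the unique $*$-homomorphism with $\bar\varrho(b)\varrho(f)=\varrho(bf)$ for $b\in C_b(X)$, $f\in C_0(X)$). For $t\in\mathbb R^d$ put $e_t(x)=\mathrm e^{\mathrm i x\cdot t}$ for $x\in X$, $\sigma_t=\bar\varrho(e_t)$, and $\operatorname{Ad}\sigma_t(S)=\sigma_t S\sigma_{-t}$ for $S\in\mathbb B(H)$. Call $S\in\mathbb B(H)$ - *continuous with respect to $\operatorname{Ad}\sigma$* if $\mathbb R^d\to\mathbb B(H)$, $t\mapsto\operatorname{Ad}\sigma_t(S)$, is continuous for the operator norm; - *locally compact* if $\varrho(f)S$ and $S\varrho(f)$ are compact operators for all $f\in C_0(X)$; - *controlled* if there is $R>0$ with $\lVert x-y\rVert\le R$ for all $(x,y)\in\operatorname{supp}S$. Here $\operatorname{supp}S\subseteq X\times X$ is the complement of the set of all $(x,y)$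 that have open neighbourhoods $U\ni x$, $V\ni y$ in $X$ with $\varrho(f)S\varrho(g)=0$ for all $f\in C_0(U)$, $g\in C_0(V)$. The Roe $C^*$-algebra $C^*_{\mathrm{Roe}}(X,\varrho)$ is the norm closure in $\mathbb B(H)$ of the set of all locally compact, controlled operators. Then: 1. An operator $S\in\mathbb B(H)$ is a norm limit of controlled operators if and only if it is continuous with respect to $\operatorname{Ad}\sigma$. 2. The set of all operators in $\mathbb B(H)$ that are both locally compact and continuous with respect to $\operatorname{Ad}\sigma$ is a $C^*$-subalgebra (a norm-closed $*$-subalgebra, not necessarily unital) of $\mathbb B(H)$, and it is equal to $C^*_{\mathrm{Roe}}(X,\varrho)$. -/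

import Mathlib

open scoped ZeroAtInfty BoundedContinuousFunction

noncomputable section

namespace Roe

section Multiplier

variable {X : Type*} [TopologicalSpace X]
  {H : Type*} [NormedAddCommGroup H] [InnerProductSpace ℂ H] [CompleteSpace H]

/-- The product `b · f ∈ C₀(X)` of a bounded continuous function `b` and `f ∈ C₀(X)`. -/
def mulC0 (b : X →ᵇ ℂ) (f : C₀(X, ℂ)) : C₀(X, ℂ) where
  toFun x := b x * f x
  continuous_toFun := b.continuous.mul f.continuous_toFun
  zero_at_infty' := by
    refine squeeze_zero_norm (a := fun x => ‖b‖ * ‖f x‖) (fun x => ?_) ?_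
    · rw [norm_mul]
      exact mul_le_mul_of_nonneg_right (b.norm_coe_le_norm x) (norm_nonneg _)
    · have h := (f.zero_at_infty'.norm).const_mul ‖b‖
      simpa using h

@[simp]
theorem mulC0_apply (b : X →ᵇ ℂ) (f : C₀(X, ℂ)) (x : X) : mulC0 b f x = b x * f x := rfl

/-- A representation `ρ` of `C₀(X)` on `H` is nondegenerate if the linear span of the vectors
`ρ(f) ξ` is dense in `H`. -/
def Nondegenerate (ρ : C₀(X, ℂ) →⋆ₙₐ[ℂ] (H →L[ℂ] H)) : Prop :=
  Dense (Submodule.span ℂ {v : H | ∃ (f : C₀(X, ℂ)) (ξ : H), ρ f ξ = v} : Set H)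

/-- The linear map sending a formal sum `∑ f ⊗ ξ` to `∑ ρ(f) ξ`. -/
def action (ρ : C₀(X, ℂ) →⋆ₙₐ[ℂ] (H →L[ℂ] H)) : (C₀(X, ℂ) →₀ H) →ₗ[ℂ] H :=
  Finsupp.lsum ℂ fun f => (ρ f).toLinearMap

/-- The linear map sending a formal sum `∑ f ⊗ ξ` to `∑ ρ(b · f) ξ`. -/
def mulAction (ρ : C₀(X, ℂ) →⋆ₙₐ[ℂ] (H →L[ℂ] H)) (b : X →ᵇ ℂ) : (C₀(X, ℂ) →₀ H) →ₗ[ℂ] H :=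
  Finsupp.lsum ℂ fun f => (ρ (mulC0 b f)).toLinearMap

theorem action_single (ρ : C₀(X, ℂ) →⋆ₙₐ[ℂ] (H →L[ℂ] H)) (f : C₀(X, ℂ)) (ξ : H) :
    action ρ (Finsupp.single f ξ) = ρ f ξ := by
  simp [action]

theorem mulAction_single (ρ : C₀(X, ℂ) →⋆ₙₐ[ℂ] (H →L[ℂ] H)) (b : X →ᵇ ℂ) (f : C₀(X, ℂ))
    (ξ : H) : mulAction ρ b (Finsupp.single f ξ) = ρ (mulC0 b f) ξ := by
  simp [mulAction]

theorem denseRange_action {ρ : C₀(X, ℂ) →⋆ₙₐ[ℂ] (H →L[ℂ] H)} (hρ : Nondegenerate ρ) :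
    DenseRange (action ρ) := by
  refine Dense.mono ?_ hρ
  have h : Submodule.span ℂ {v : H | ∃ (f : C₀(X, ℂ)) (ξ : H), ρ f ξ = v}
      ≤ LinearMap.range (action ρ) := by
    rw [Submodule.span_le]
    rintro _ ⟨f, ξ, rfl⟩
    exact ⟨Finsupp.single f ξ, action_single ρ f ξ⟩
  exact h

theorem inner_map (ρ : C₀(X, ℂ) →⋆ₙₐ[ℂ] (H →L[ℂ] H)) (f g : C₀(X, ℂ)) (ξ η : H) :
    inner ℂ (ρ f ξ) (ρ g η) = inner ℂ ξ (ρ (star f * g) η) := by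
  rw [map_mul, map_star, ContinuousLinearMap.star_eq_adjoint, mul_apply_eq_comp,
    ContinuousLinearMap.adjoint_inner_right]

theorem norm_mulAction_le (ρ : C₀(X, ℂ) →⋆ₙₐ[ℂ] (H →L[ℂ] H)) (b : X →ᵇ ℂ)
    (s : C₀(X, ℂ) →₀ H) : ‖mulAction ρ b s‖ ≤ ‖b‖ * ‖action ρ s‖ := by
  have hnn : ∀ x, 0 ≤ ‖b‖ ^ 2 - ‖b x‖ ^ 2 := fun x => by
    have := b.norm_coe_le_norm x
    nlinarith [norm_nonneg (b x)]
  let c : X →ᵇ ℂ := BoundedContinuousFunction.ofNormedAddCommGroup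
    (fun x => ((Real.sqrt (‖b‖ ^ 2 - ‖b x‖ ^ 2) : ℝ) : ℂ)) (by fun_prop) ‖b‖ (fun x => by
      rw [Complex.norm_real, Real.norm_of_nonneg (Real.sqrt_nonneg _)]
      rw [Real.sqrt_le_left (norm_nonneg _)]
      nlinarith [sq_nonneg ‖b x‖])
  have hc : ∀ x, c x = ((Real.sqrt (‖b‖ ^ 2 - ‖b x‖ ^ 2) : ℝ) : ℂ) := fun x => rfl
  have key : ∀ f g : C₀(X, ℂ),
      star (mulC0 b f) * mulC0 b g + star (mulC0 c f) * mulC0 c g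
        = ((‖b‖ ^ 2 : ℝ) : ℂ) • (star f * g) := by
    intro f g
    ext x
    have h1 : starRingEnd ℂ (b x) * b x = ((‖b x‖ ^ 2 : ℝ) : ℂ) := by
      rw [← Complex.normSq_eq_conj_mul_self, Complex.normSq_eq_norm_sq]
    have h2 : starRingEnd ℂ (c x) * c x = ((‖b‖ ^ 2 - ‖b x‖ ^ 2 : ℝ) : ℂ) := by
      rw [hc, Complex.conj_ofReal, ← Complex.ofReal_mul, Real.mul_self_sqrt (hnn x)]
    have h3 : starRingEnd ℂ (b x) * b x + starRingEnd ℂ (c x) * c x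
        = ((‖b‖ ^ 2 : ℝ) : ℂ) := by
      rw [h1, h2, ← Complex.ofReal_add]
      congr 1
      ring
    simp only [ZeroAtInftyContinuousMap.add_apply, ZeroAtInftyContinuousMap.mul_apply,
      ZeroAtInftyContinuousMap.star_apply, ZeroAtInftyContinuousMap.smul_apply, mulC0_apply,
      smul_eq_mul, star_mul', RCLike.star_def]
    rw [← h3]
    ring
  have hin : inner ℂ (mulAction ρ b s) (mulAction ρ b s)
      + inner ℂ (mulAction ρ c s) (mulAction ρ c s)
      = ((‖b‖ ^ 2 : ℝ) : ℂ) * inner ℂ (action ρ s) (action ρ s) := by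
    simp only [mulAction, action, Finsupp.lsum_apply, Finsupp.sum, sum_inner, inner_sum,
      ContinuousLinearMap.coe_coe, inner_map]
    rw [← Finset.sum_add_distrib, Finset.mul_sum]
    refine Finset.sum_congr rfl fun f _ => ?_
    rw [← Finset.sum_add_distrib, Finset.mul_sum]
    refine Finset.sum_congr rfl fun g _ => ?_
    rw [← inner_add_right, ← add_apply, ← map_add, key, map_smul,
      smul_apply, inner_smul_right]
  simp only [inner_self_eq_norm_sq_to_K] at hin
  have hin' : ‖mulAction ρ b s‖ ^ 2 + ‖mulAction ρ c s‖ ^ 2 = ‖b‖ ^ 2 * ‖action ρ s‖ ^ 2 := by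
    apply Complex.ofReal_injective
    push_cast at hin ⊢
    exact hin
  refine abs_le_of_sq_le_sq' ?_ (by positivity) |>.2
  nlinarith [sq_nonneg ‖mulAction ρ c s‖]

/-- The operator that sends `ρ(f) ξ` to `ρ(b · f) ξ`. -/
def multiplierOp (ρ : C₀(X, ℂ) →⋆ₙₐ[ℂ] (H →L[ℂ] H)) (b : X →ᵇ ℂ) : H →L[ℂ] H :=
  (mulAction ρ b).extendOfNorm (action ρ)

theorem multiplierOp_apply {ρ : C₀(X, ℂ) →⋆ₙₐ[ℂ] (H →L[ℂ] H)} (hρ : Nondegenerate ρ)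
    (b : X →ᵇ ℂ) (f : C₀(X, ℂ)) (ξ : H) : multiplierOp ρ b (ρ f ξ) = ρ (mulC0 b f) ξ := by
  rw [← action_single, ← mulAction_single]
  exact LinearMap.extendOfNorm_eq (denseRange_action hρ) ⟨‖b‖, norm_mulAction_le ρ b⟩ _

theorem ext_of_nondegenerate {ρ : C₀(X, ℂ) →⋆ₙₐ[ℂ] (H →L[ℂ] H)} (hρ : Nondegenerate ρ)
    {S T : H →L[ℂ] H} (h : ∀ (f : C₀(X, ℂ)) (ξ : H), S (ρ f ξ) = T (ρ f ξ)) : S = T := by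
  refine ContinuousLinearMap.ext_on hρ ?_
  rintro _ ⟨f, ξ, rfl⟩
  exact h f ξ

/-- The canonical extension `ρ̄ : C_b(X) → B(H)` of a nondegenerate representation `ρ` of `C₀(X)`,
characterised by `ρ̄(b) ρ(f) = ρ(b · f)` for `b ∈ C_b(X)` and `f ∈ C₀(X)`. -/
def multiplierExtension (ρ : C₀(X, ℂ) →⋆ₙₐ[ℂ] (H →L[ℂ] H)) (hρ : Nondegenerate ρ) :
    (X →ᵇ ℂ) →⋆ₐ[ℂ] (H →L[ℂ] H) where
  toFun := multiplierOp ρ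
  map_one' := ext_of_nondegenerate hρ fun f ξ => by
    rw [multiplierOp_apply hρ, one_apply_eq_self]
    congr 2
    ext x
    simp
  map_mul' a b := ext_of_nondegenerate hρ fun f ξ => by
    rw [mul_apply_eq_comp]
    simp only [multiplierOp_apply hρ]
    congr 2
    ext x
    simp [mul_assoc]
  map_zero' := ext_of_nondegenerate hρ fun f ξ => by
    have h : mulC0 (0 : X →ᵇ ℂ) f = 0 := by ext x; simp
    rw [multiplierOp_apply hρ, h, map_zero]
    simp
  map_add' a b := ext_of_nondegenerate hρ fun f ξ => by
    have h : mulC0 (a + b) f = mulC0 a f + mulC0 b f := by ext x; simp [add_mul]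
    rw [add_apply]
    simp only [multiplierOp_apply hρ]
    rw [h, map_add, add_apply]
  commutes' z := ext_of_nondegenerate hρ fun f ξ => by
    have h : mulC0 (algebraMap ℂ (X →ᵇ ℂ) z) f = z • f := by ext x; simp
    rw [multiplierOp_apply hρ, h, map_smul, smul_apply]
    simp [Algebra.algebraMap_eq_smul_one]
  map_star' b := ext_of_nondegenerate hρ fun f ξ => by
    have h1 : ρ (star f) * multiplierOp ρ b = ρ (mulC0 b (star f)) :=
      ext_of_nondegenerate hρ fun g η => by
        rw [mul_apply_eq_comp, multiplierOp_apply hρ,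
          ← mul_apply_eq_comp, ← mul_apply_eq_comp, ← map_mul, ← map_mul]
        congr 2
        ext x
        simp
        ring
    have h2 := congrArg star h1
    rw [star_mul, ← map_star, ← map_star, star_star] at h2
    rw [multiplierOp_apply hρ, ← mul_apply_eq_comp, h2]
    congr 2
    ext x
    simp

theorem multiplierExtension_apply (ρ : C₀(X, ℂ) →⋆ₙₐ[ℂ] (H →L[ℂ] H)) (hρ : Nondegenerate ρ)
    (b : X →ᵇ ℂ) (f : C₀(X, ℂ)) (ξ : H) :
    multiplierExtension ρ hρ b (ρ f ξ) = ρ (mulC0 b f) ξ :=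
  multiplierOp_apply hρ b f ξ

/-- `ρ̄` restricts to `ρ` on `C₀(X)`. -/
theorem multiplierExtension_toBCF (ρ : C₀(X, ℂ) →⋆ₙₐ[ℂ] (H →L[ℂ] H)) (hρ : Nondegenerate ρ)
    (f : C₀(X, ℂ)) : multiplierExtension ρ hρ f.toBCF = ρ f :=
  ext_of_nondegenerate hρ fun g η => by
    rw [multiplierExtension_apply, ← mul_apply_eq_comp, ← map_mul]
    rfl

/-- `ρ̄` is the only extension of `ρ` to a multiplicative map on `C_b(X)`. -/
theorem multiplierExtension_unique (ρ : C₀(X, ℂ) →⋆ₙₐ[ℂ] (H →L[ℂ] H)) (hρ : Nondegenerate ρ)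
    (π : (X →ᵇ ℂ) →⋆ₐ[ℂ] (H →L[ℂ] H)) (hπ : ∀ f : C₀(X, ℂ), π f.toBCF = ρ f) :
    π = multiplierExtension ρ hρ := by
  refine StarAlgHom.ext fun b => ext_of_nondegenerate hρ fun f ξ => ?_
  rw [multiplierExtension_apply, ← hπ f, ← mul_apply_eq_comp, ← map_mul, ← hπ]
  rfl

/-- `T` is locally compact if `ρ(f) T` and `T ρ(f)` are compact for all `f ∈ C₀(X)`. -/
def IsLocallyCompact (ρ : C₀(X, ℂ) →⋆ₙₐ[ℂ] (H →L[ℂ] H)) (T : H →L[ℂ] H) : Prop :=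
  ∀ f : C₀(X, ℂ), IsCompactOperator (ρ f * T) ∧ IsCompactOperator (T * ρ f)

/-- The support of `T`: the complement of the set of all `(x, y)` having open neighbourhoods
`U ∋ x` and `V ∋ y` with `ρ(f) T ρ(g) = 0` for all `f ∈ C₀(U)` and `g ∈ C₀(V)`. Here `C₀(U)` is
the ideal of those functions in `C₀(X)` that vanish outside `U`. -/
def supp (ρ : C₀(X, ℂ) →⋆ₙₐ[ℂ] (H →L[ℂ] H)) (T : H →L[ℂ] H) : Set (X × X) :=
  {p | ∃ U V : Set X, IsOpen U ∧ IsOpen V ∧ p.1 ∈ U ∧ p.2 ∈ V ∧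
    ∀ f g : C₀(X, ℂ), (∀ x ∉ U, f x = 0) → (∀ y ∉ V, g y = 0) → ρ f * T * ρ g = 0}ᶜ

end Multiplier

section Metric

variable {X : Type*} [MetricSpace X]
  {H : Type*} [NormedAddCommGroup H] [InnerProductSpace ℂ H] [CompleteSpace H]

/-- `T` is controlled (has finite propagation) if there is `R > 0` such that `d(x, y) ≤ R` for all
`(x, y)` in the support of `T`. -/
def IsControlled (ρ : C₀(X, ℂ) →⋆ₙₐ[ℂ] (H →L[ℂ] H)) (T : H →L[ℂ] H) : Prop :=
  ∃ R : ℝ, 0 < R ∧ ∀ p ∈ supp ρ T, dist p.1 p.2 ≤ R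

/-- The (underlying set of the) Roe C⋆-algebra of `X` with respect to `ρ`: the closure, in the
operator norm, of the set of locally compact, controlled operators. -/
def roeAlgebra (ρ : C₀(X, ℂ) →⋆ₙₐ[ℂ] (H →L[ℂ] H)) : Set (H →L[ℂ] H) :=
  closure {T | IsLocallyCompact ρ T ∧ IsControlled ρ T}

end Metric

section Euclidean

variable {d : ℕ} {X : Set (EuclideanSpace ℝ (Fin d))}
  {H : Type*} [NormedAddCommGroup H] [InnerProductSpace ℂ H] [CompleteSpace H]

/-- The bounded continuous function `e_t(x) = exp(i x·t)` on `X ⊆ ℝᵈ`. -/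
def expFun (X : Set (EuclideanSpace ℝ (Fin d))) (t : EuclideanSpace ℝ (Fin d)) : X →ᵇ ℂ :=
  BoundedContinuousFunction.ofNormedAddCommGroup
    (fun x => Complex.exp (Complex.I * ((inner ℝ (x : EuclideanSpace ℝ (Fin d)) t : ℝ) : ℂ)))
    (by fun_prop) 1
    (fun x => by rw [mul_comm, Complex.norm_exp_ofReal_mul_I])

/-- The representation `σ_t = ρ̄(e_t)` of `ℝᵈ` on `H` generated by the position operators. -/
def sigma (ρ : C₀(X, ℂ) →⋆ₙₐ[ℂ] (H →L[ℂ] H)) (hρ : Nondegenerate ρ)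
    (t : EuclideanSpace ℝ (Fin d)) : H →L[ℂ] H :=
  multiplierExtension ρ hρ (expFun X t)

/-- The action `Ad σ_t (S) = σ_t S σ_t⁻¹ = σ_t S σ_{-t}` of `ℝᵈ` on `B(H)`. -/
def adSigma (ρ : C₀(X, ℂ) →⋆ₙₐ[ℂ] (H →L[ℂ] H)) (hρ : Nondegenerate ρ)
    (t : EuclideanSpace ℝ (Fin d)) (S : H →L[ℂ] H) : H →L[ℂ] H :=
  sigma ρ hρ t * S * sigma ρ hρ (-t)

/-- `S` is continuous with respect to `Ad σ` if `t ↦ Ad σ_t (S)` is continuous for the operator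
norm. -/
def IsAdContinuous (ρ : C₀(X, ℂ) →⋆ₙₐ[ℂ] (H →L[ℂ] H)) (hρ : Nondegenerate ρ)
    (S : H →L[ℂ] H) : Prop :=
  Continuous fun t : EuclideanSpace ℝ (Fin d) => adSigma ρ hρ t S

end Euclidean

end Roe

end

noncomputable section

namespace Roe

/-! ### Local-to-global principle for supports. -/

section Locality

variable {X : Type*} [TopologicalSpace X]
  {H : Type*} [NormedAddCommGroup H] [InnerProductSpace ℂ H] [CompleteSpace H]

/-! Think of `S` as a kernel `S(x, y)`: then `Ad σ_t` multiplies it by `exp(i (x - y)·t)`, so small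
propagation should mean slow variation in `t`, and averaging over `t` should cut the propagation
down.

Controlled implies continuous: by `norm_commutator_expI_le`, an operator of propagation at most `R`
commutes with `exp(i θ)` up to a multiple of the variation of `θ` at distance slightly above `R`.
One replaces `θ` by a staircase function, whose exponential commutes exactly with `T` after a cutoff
to its flat parts (`multiplier_commute_of_supp`); two staircases shifted by half a step cover all of
`X`. For `θ(x) = x·t` this makes `t ↦ Ad σ_t(T)` Lipschitz, and Ad-continuity survives norm limits.

Continuous implies limit of controlled: for a Schwartz function `ψ` with compactly supported Fourier
transform, `∫ |ψ(t)|² Ad σ_{ct}(S) dt` tends to a positive multiple of `S` as `c → 0`. On kernels it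
multiplies by the transform of `|ψ|²` at a multiple of `c (x - y)`, which has compact support, so it
is controlled; `rep_mul_smoothing_mul_rep_eq_zero` makes this rigorous by Parseval.

The integral stays in every closed subspace containing all `Ad σ_t(S)`. Applied to the locally
compact operators, this gives the second claim. -/

theorem norm_multiplierExtension_le (ρ : C₀(X, ℂ) →⋆ₙₐ[ℂ] (H →L[ℂ] H)) (hρ : Nondegenerate ρ)
    (b : X →ᵇ ℂ) : ‖multiplierExtension ρ hρ b‖ ≤ ‖b‖ :=
  NonUnitalStarAlgHom.norm_apply_le (multiplierExtension ρ hρ) b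

theorem norm_rep_le (ρ : C₀(X, ℂ) →⋆ₙₐ[ℂ] (H →L[ℂ] H)) (f : C₀(X, ℂ)) : ‖ρ f‖ ≤ ‖f‖ :=
  NonUnitalStarAlgHom.norm_apply_le ρ f

theorem continuous_rep (ρ : C₀(X, ℂ) →⋆ₙₐ[ℂ] (H →L[ℂ] H)) : Continuous ρ :=
  AddMonoidHomClass.continuous_of_bound ρ 1 fun f => by simpa using norm_rep_le ρ f

theorem multiplierExtension_mul_rep (ρ : C₀(X, ℂ) →⋆ₙₐ[ℂ] (H →L[ℂ] H)) (hρ : Nondegenerate ρ)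
    (b : X →ᵇ ℂ) (f : C₀(X, ℂ)) : multiplierExtension ρ hρ b * ρ f = ρ (mulC0 b f) := by
  ext ξ
  exact multiplierExtension_apply ρ hρ b f ξ

theorem rep_mul_multiplierExtension (ρ : C₀(X, ℂ) →⋆ₙₐ[ℂ] (H →L[ℂ] H)) (hρ : Nondegenerate ρ)
    (b : X →ᵇ ℂ) (f : C₀(X, ℂ)) : ρ f * multiplierExtension ρ hρ b = ρ (mulC0 b f) := by
  have h := congrArg star (multiplierExtension_mul_rep ρ hρ (star b) (star f))
  rw [star_mul, ← map_star, ← map_star, ← map_star, star_star, star_star] at h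
  rw [h]
  congr 1
  ext x
  simp

/-- An element of `C₀(X)` belongs to a closed subgroup as soon as it does so locally. -/
theorem mem_of_locally_mem [T2Space X] [NormalSpace X] [ParacompactSpace X] {g : C₀(X, ℂ)}
    {N : AddSubgroup C₀(X, ℂ)} (hN : IsClosed (N : Set C₀(X, ℂ)))
    (h : ∀ y, ∃ V : Set X, IsOpen V ∧ y ∈ V ∧
      ∀ ψ : X →ᵇ ℂ, (∀ x ∉ V, ψ x = 0) → mulC0 ψ g ∈ N) : g ∈ N := by
  choose V hVo hyV hV using h
  obtain ⟨p, hp⟩ := PartitionOfUnity.exists_isSubordinate isClosed_univ V hVo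
    (fun y _ => Set.mem_iUnion.2 ⟨y, hyV y⟩)
  classical
  have hle : ∀ (s : Finset X) x, ∑ i ∈ s, p i x ≤ 1 := fun s x => by
    refine le_trans ?_ (p.sum_le_one x)
    -- Adding the finitely many indices active at `x` turns the full sum into a finite one that
    -- dominates the sum over `s`.
    rw [finsum_eq_sum_of_support_subset _ (s := s ∪ (p.locallyFinite.point_finite x).toFinset)
      (fun i hi => by simp only [Finset.coe_union, Set.Finite.coe_toFinset]; exact Or.inr hi)]
    exact Finset.sum_le_sum_of_subset_of_nonneg Finset.subset_union_left
      fun i _ _ => p.nonneg i x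
  let q : X → X →ᵇ ℂ := fun i => BoundedContinuousFunction.ofNormedAddCommGroup
    (fun x => ((p i x : ℝ) : ℂ)) (by fun_prop) 1 (fun x => by
      rw [Complex.norm_real, Real.norm_of_nonneg (p.nonneg i x)]
      exact p.le_one i x)
  have hq : ∀ i x, q i x = ((p i x : ℝ) : ℂ) := fun i x => rfl
  have hmem : ∀ s : Finset X, ∑ i ∈ s, mulC0 (q i) g ∈ N := fun s =>
    N.sum_mem fun i _ => hV i (q i) fun x hx => by
      rw [hq, image_eq_zero_of_notMem_tsupport fun hx' => hx (hp i hx'), Complex.ofReal_zero]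
  have hsum : ∀ (s : Finset X) x, (∑ i ∈ s, mulC0 (q i) g) x = ((∑ i ∈ s, p i x : ℝ) : ℂ) * g x := by
    intro s x
    have : (∑ i ∈ s, mulC0 (q i) g) x = ∑ i ∈ s, mulC0 (q i) g x := by
      induction s using Finset.cons_induction with
      | empty => simp
      | cons a s ha ih =>
        rw [Finset.sum_cons, Finset.sum_cons, ← ih, ZeroAtInftyContinuousMap.add_apply]
    rw [this]
    push_cast
    rw [Finset.sum_mul]
    rfl
  rw [← SetLike.mem_coe, ← hN.closure_eq, Metric.mem_closure_iff]
  intro ε hε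
  have hK : ∃ K : Set X, IsCompact K ∧ ∀ x ∉ K, ‖g x‖ < ε / 2 := by
    have h1 := g.zero_at_infty'.norm
    rw [norm_zero] at h1
    have h2 := h1.eventually (gt_mem_nhds (half_pos hε))
    obtain ⟨K, hKc, hK⟩ := Filter.mem_cocompact.1 h2
    exact ⟨K, hKc, fun x hx => hK hx⟩
  obtain ⟨K, hKc, hK⟩ := hK
  -- The finitely many members that meet `K` sum to `1` on `K`; off `K` the error is at most `‖g x‖
  -- < ε / 2`.
  have hfin := p.locallyFinite.finite_nonempty_inter_compact hKc
  refine ⟨_, hmem hfin.toFinset, lt_of_le_of_lt ?_ (half_lt_self hε)⟩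
  rw [← ZeroAtInftyContinuousMap.dist_toBCF_eq_dist,
    BoundedContinuousFunction.dist_le (half_pos hε).le]
  intro x
  change dist (g x) ((∑ i ∈ hfin.toFinset, mulC0 (q i) g) x) ≤ _
  rw [hsum, dist_eq_norm]
  have h0 : 0 ≤ ∑ i ∈ hfin.toFinset, p i x := Finset.sum_nonneg fun i _ => p.nonneg i x
  by_cases hx : x ∈ K
  · have h1 : ∑ i ∈ hfin.toFinset, p i x = 1 := by
      rw [← p.sum_eq_one (Set.mem_univ x), finsum_eq_sum_of_support_subset]
      intro i hi
      rw [Set.Finite.coe_toFinset]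
      exact ⟨x, hi, hx⟩
    rw [h1]
    simp only [Complex.ofReal_one, one_mul, sub_self, norm_zero]
    positivity
  · have h2 : g x - ((∑ i ∈ hfin.toFinset, p i x : ℝ) : ℂ) * g x
        = ((1 - ∑ i ∈ hfin.toFinset, p i x : ℝ) : ℂ) * g x := by
      push_cast
      ring
    rw [h2, norm_mul, Complex.norm_real, Real.norm_of_nonneg (by linarith [hle hfin.toFinset x])]
    nlinarith [hK x hx, norm_nonneg (g x)]

/-- The functions `g` with `A ρ(g) = 0`. -/
def rightAnnihilator (ρ : C₀(X, ℂ) →⋆ₙₐ[ℂ] (H →L[ℂ] H)) (A : H →L[ℂ] H) :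
    AddSubgroup C₀(X, ℂ) where
  carrier := {g | A * ρ g = 0}
  add_mem' {a b} ha hb := by
    simp only [Set.mem_ofPred_eq] at ha hb ⊢
    rw [map_add, mul_add, ha, hb, add_zero]
  zero_mem' := by simp
  neg_mem' {a} ha := by
    simp only [Set.mem_ofPred_eq] at ha ⊢
    rw [map_neg, mul_neg, ha, neg_zero]

/-- The functions `f` with `ρ(f) A = 0`. -/
def leftAnnihilator (ρ : C₀(X, ℂ) →⋆ₙₐ[ℂ] (H →L[ℂ] H)) (A : H →L[ℂ] H) :
    AddSubgroup C₀(X, ℂ) where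
  carrier := {f | ρ f * A = 0}
  add_mem' {a b} ha hb := by
    simp only [Set.mem_ofPred_eq] at ha hb ⊢
    rw [map_add, add_mul, ha, hb, add_zero]
  zero_mem' := by simp
  neg_mem' {a} ha := by
    simp only [Set.mem_ofPred_eq] at ha ⊢
    rw [map_neg, neg_mul, ha, neg_zero]

theorem mem_rightAnnihilator {ρ : C₀(X, ℂ) →⋆ₙₐ[ℂ] (H →L[ℂ] H)} {A : H →L[ℂ] H}
    {g : C₀(X, ℂ)} : g ∈ rightAnnihilator ρ A ↔ A * ρ g = 0 := Iff.rfl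

theorem mem_leftAnnihilator {ρ : C₀(X, ℂ) →⋆ₙₐ[ℂ] (H →L[ℂ] H)} {A : H →L[ℂ] H}
    {g : C₀(X, ℂ)} : g ∈ leftAnnihilator ρ A ↔ ρ g * A = 0 := Iff.rfl

theorem isClosed_rightAnnihilator (ρ : C₀(X, ℂ) →⋆ₙₐ[ℂ] (H →L[ℂ] H)) (A : H →L[ℂ] H) :
    IsClosed (rightAnnihilator ρ A : Set C₀(X, ℂ)) :=
  isClosed_eq (continuous_const.mul (continuous_rep ρ)) continuous_const

theorem isClosed_leftAnnihilator (ρ : C₀(X, ℂ) →⋆ₙₐ[ℂ] (H →L[ℂ] H)) (A : H →L[ℂ] H) :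
    IsClosed (leftAnnihilator ρ A : Set C₀(X, ℂ)) :=
  isClosed_eq ((continuous_rep ρ).mul continuous_const) continuous_const

theorem eq_zero_of_mul_rep {ρ : C₀(X, ℂ) →⋆ₙₐ[ℂ] (H →L[ℂ] H)} (hρ : Nondegenerate ρ)
    {A : H →L[ℂ] H} (h : ∀ g, A * ρ g = 0) : A = 0 :=
  ext_of_nondegenerate hρ fun f ξ => by
    rw [← mul_apply_eq_comp, h]
    simp

theorem eq_zero_of_rep_mul {ρ : C₀(X, ℂ) →⋆ₙₐ[ℂ] (H →L[ℂ] H)} (hρ : Nondegenerate ρ)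
    {A : H →L[ℂ] H} (h : ∀ f, ρ f * A = 0) : A = 0 := by
  rw [← star_eq_zero]
  refine eq_zero_of_mul_rep hρ fun g => ?_
  rw [← star_star g, map_star, ← star_mul, h, star_zero]

/-- An operator with empty support vanishes. -/
theorem eq_zero_of_supp_eq_empty [LocallyCompactSpace X] [T2Space X] [NormalSpace X]
    [ParacompactSpace X] {ρ : C₀(X, ℂ) →⋆ₙₐ[ℂ] (H →L[ℂ] H)} (hρ : Nondegenerate ρ)
    {A : H →L[ℂ] H} (hA : supp ρ A = ∅) : A = 0 := by
  have hA' : ∀ x y, ∃ U V : Set X, IsOpen U ∧ IsOpen V ∧ x ∈ U ∧ y ∈ V ∧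
      ∀ f g : C₀(X, ℂ), (∀ x ∉ U, f x = 0) → (∀ y ∉ V, g y = 0) → ρ f * A * ρ g = 0 := by
    intro x y
    have : (x, y) ∉ supp ρ A := by simp [hA]
    simpa only [supp, Set.notMem_compl_iff, Set.mem_ofPred_eq] using this
  choose U V hUo hVo hxU hyV hUV using hA'
  refine eq_zero_of_mul_rep hρ fun g => ?_
  refine mem_rightAnnihilator.1 (mem_of_locally_mem (isClosed_rightAnnihilator ρ A) fun y => ?_)
  -- The neighbourhoods `V x y` depend on `x`. Once `g` is cut down to a compact `K`, finitely many
  -- of them cover `K` for each `x`, and the matching `U x i` can be intersected.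
  obtain ⟨K, hK, hyK⟩ := exists_compact_mem_nhds y
  refine ⟨interior K, isOpen_interior, mem_interior_iff_mem_nhds.2 hyK, fun ψ hψ => ?_⟩
  rw [mem_rightAnnihilator]
  refine eq_zero_of_rep_mul hρ fun f => ?_
  refine mem_leftAnnihilator.1 (mem_of_locally_mem (isClosed_leftAnnihilator ρ _) fun x => ?_)
  obtain ⟨s, -, hs⟩ := hK.elim_nhds_subcover (V x) fun y _ => (hVo x y).mem_nhds (hyV x y)
  refine ⟨⋂ i ∈ s, U x i, isOpen_biInter_finset fun i _ => hUo x i,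
    Set.mem_iInter₂.2 fun i _ => hxU x i, fun θ hθ => ?_⟩
  rw [mem_leftAnnihilator, ← mul_assoc]
  refine mem_rightAnnihilator.1 (mem_of_locally_mem (isClosed_rightAnnihilator ρ _) fun z => ?_)
  by_cases hz : z ∈ K
  · obtain ⟨i, hi, hzi⟩ := Set.mem_iUnion₂.1 (hs hz)
    refine ⟨V x i, hVo x i, hzi, fun χ hχ => ?_⟩
    rw [mem_rightAnnihilator]
    refine hUV x i _ _ (fun a ha => ?_) fun a ha => ?_
    · rw [mulC0_apply, hθ a fun ha' => ha (Set.mem_iInter₂.1 ha' i hi), zero_mul]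
    · rw [mulC0_apply, hχ a ha, zero_mul]
  · refine ⟨Kᶜ, hK.isClosed.isOpen_compl, hz, fun χ hχ => ?_⟩
    have : mulC0 χ (mulC0 ψ g) = 0 := by
      ext a
      by_cases ha : a ∈ K
      · simp [hχ a (by simpa using ha)]
      · simp [hψ a fun ha' => ha (interior_subset ha')]
    rw [this]
    exact AddSubgroup.zero_mem _

end Locality

/-! ### Exact commutation with locally constant multipliers. -/

section Commutator

variable {X : Type*} [MetricSpace X] [LocallyCompactSpace X]
  {H : Type*} [NormedAddCommGroup H] [InnerProductSpace ℂ H] [CompleteSpace H]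

/-- If `T` has propagation at most `R` and `g` is constant at distance at most `R' > R` from any
point where `P` does not vanish, then `g` commutes with `T` up to right multiplication by `P`. -/
theorem multiplier_commute_of_supp {ρ : C₀(X, ℂ) →⋆ₙₐ[ℂ] (H →L[ℂ] H)} (hρ : Nondegenerate ρ)
    {T : H →L[ℂ] H} {R R' : ℝ} (hRR : R < R') (hT : ∀ p ∈ supp ρ T, dist p.1 p.2 ≤ R)
    {g P : X →ᵇ ℂ} (hgP : ∀ x y, dist x y ≤ R' → P y ≠ 0 → g x = g y) :
    multiplierExtension ρ hρ g * T * multiplierExtension ρ hρ P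
      = T * multiplierExtension ρ hρ g * multiplierExtension ρ hρ P := by
  rw [← sub_eq_zero]
  refine eq_zero_of_supp_eq_empty hρ ?_
  have key : ∀ f h : C₀(X, ℂ), ρ f * (multiplierExtension ρ hρ g * T * multiplierExtension ρ hρ P
      - T * multiplierExtension ρ hρ g * multiplierExtension ρ hρ P) * ρ h
      = ρ (mulC0 g f) * T * ρ (mulC0 P h) - ρ f * T * ρ (mulC0 g (mulC0 P h)) := by
    intro f h
    rw [← multiplierExtension_mul_rep ρ hρ g (mulC0 P h), ← multiplierExtension_mul_rep ρ hρ P h,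
      ← rep_mul_multiplierExtension ρ hρ g f]
    noncomm_ring
  rw [Set.eq_empty_iff_forall_notMem]
  rintro ⟨x, y⟩
  rw [supp, Set.notMem_compl_iff]
  by_cases hxy : (x, y) ∈ supp ρ T
  · have hd : dist x y ≤ R := hT _ hxy
    -- With this radius, points of the balls around `x` and `y` are still at distance at most `R'`.
    set ε := (R' - R) / 2 with hε
    have hε0 : 0 < ε := by rw [hε]; linarith
    refine ⟨Metric.ball x ε, Metric.ball y ε, Metric.isOpen_ball, Metric.isOpen_ball,
      Metric.mem_ball_self hε0, Metric.mem_ball_self hε0, fun f h hf hh => ?_⟩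
    have hdist : ∀ a ∈ Metric.ball x ε, ∀ b ∈ Metric.ball y ε, dist a b ≤ R' := by
      intro a ha b hb
      have h1 := dist_triangle4 a x y b
      rw [Metric.mem_ball] at ha hb
      rw [dist_comm y b] at h1
      linarith
    rw [key]
    -- If `P` is nonzero at some `b` near `y`, then `g` equals `g b` near `x` and wherever `P` is
    -- nonzero near `y`, so both terms are `g b` times the same operator. Otherwise `P h = 0`.
    by_cases hP : ∃ b ∈ Metric.ball y ε, P b ≠ 0
    · obtain ⟨b, hb, hPb⟩ := hP
      have h1 : mulC0 g f = g b • f := by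
        ext a
        by_cases ha : a ∈ Metric.ball x ε
        · simp [hgP a b (hdist a ha b hb) hPb]
        · simp [hf a ha]
      have h2 : mulC0 g (mulC0 P h) = g b • mulC0 P h := by
        ext c
        by_cases hc : c ∈ Metric.ball y ε ∧ P c ≠ 0
        · have := hgP x b (hdist x (Metric.mem_ball_self hε0) b hb) hPb
          have h3 := hgP x c (hdist x (Metric.mem_ball_self hε0) c hc.1) hc.2
          simp [← this, ← h3]
        · rcases not_and_or.1 hc with hc | hc
          · simp [hh c hc]
          · simp [not_not.1 hc]
      rw [h1, h2, map_smul, map_smul, smul_mul_assoc, smul_mul_assoc, mul_smul_comm, sub_self]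
    · push Not at hP
      have h1 : mulC0 P h = 0 := by
        ext c
        by_cases hc : c ∈ Metric.ball y ε
        · simp [hP c hc]
        · simp [hh c hc]
      have h2 : mulC0 g (0 : C₀(X, ℂ)) = 0 := by ext; simp
      simp [h1, h2]
  · rw [supp, Set.notMem_compl_iff] at hxy
    obtain ⟨U, V, hU, hV, hx, hy, h⟩ := hxy
    refine ⟨U, V, hU, hV, hx, hy, fun f k hf hk => ?_⟩
    rw [key, h _ _ _ _, h _ _ _ _, sub_zero]
    · exact hf
    · intro a ha; simp [hk a ha]
    · intro a ha; simp [hf a ha]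
    · intro a ha; simp [hk a ha]

end Commutator

/-! ### Staircase and cutoff functions on the line. -/

section Staircase

/-- A continuous function that is equal to the integer `k` at distance at most `2 / 5` from `k`. -/
def stair (s : ℝ) : ℝ := s + (max 0 (min 1 (5 * Int.fract s - 2)) - Int.fract s)

/-- A continuous function of period `1` that vanishes outside the `3 / 10`-neighbourhood of the
integers and is `1` on their `1 / 5`-neighbourhood. -/
def tooth (s : ℝ) : ℝ := max 0 (min 1 (10 * |Int.fract s - 1 / 2| - 2))

/-- Writing the staircase as `s` plus a function of `Int.fract s` leaves only one check: that
function has the same value at `0` and `1`. -/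
theorem continuous_stair : Continuous stair := by
  refine continuous_id.add (ContinuousOn.comp_fract''
    (f := fun p : ℝ => max 0 (min 1 (5 * p - 2)) - p) (by fun_prop) ?_)
  norm_num

theorem continuous_tooth : Continuous tooth := by
  refine ContinuousOn.comp_fract'' (f := fun p : ℝ => max 0 (min 1 (10 * |p - 1 / 2| - 2)))
    (by fun_prop) ?_
  norm_num

theorem stair_eq {s : ℝ} {k : ℤ} (h : |s - k| ≤ 2 / 5) : stair s = k := by
  rw [abs_le] at h
  have h1 := Int.self_sub_floor s
  rcases le_or_gt (k : ℝ) s with hk | hk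
  · have hf : ⌊s⌋ = k := Int.floor_eq_iff.2 ⟨hk, by linarith⟩
    rw [hf] at h1
    rw [stair, ← h1, min_eq_right (by linarith), max_eq_left (by linarith)]
    ring
  · have hf : ⌊s⌋ = k - 1 := Int.floor_eq_iff.2 ⟨by push_cast; linarith, by push_cast; linarith⟩
    rw [hf] at h1
    push_cast at h1
    rw [stair, ← h1, min_eq_left (by linarith), max_eq_right (by linarith)]
    ring

theorem abs_stair_sub_le (s : ℝ) : |stair s - s| ≤ 1 := by
  have h1 := Int.fract_nonneg s
  have h2 := (Int.fract_lt_one s).le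
  have h3 : max 0 (min 1 (5 * Int.fract s - 2)) ≤ 1 := max_le zero_le_one (min_le_left _ _)
  have h4 : 0 ≤ max 0 (min 1 (5 * Int.fract s - 2)) := le_max_left _ _
  rw [stair, abs_le]
  constructor <;> linarith

theorem tooth_nonneg (s : ℝ) : 0 ≤ tooth s := le_max_left _ _

theorem tooth_le_one (s : ℝ) : tooth s ≤ 1 := max_le zero_le_one (min_le_left _ _)

theorem exists_int_of_tooth_ne_zero {s : ℝ} (h : tooth s ≠ 0) : ∃ k : ℤ, |s - k| ≤ 3 / 10 := by
  have h1 : 1 / 5 < |Int.fract s - 1 / 2| := by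
    by_contra! hc
    refine h (max_eq_left (le_trans (min_le_right _ _) ?_))
    linarith
  have h2 := Int.self_sub_floor s
  have h3 := Int.fract_nonneg s
  have h4 := Int.fract_lt_one s
  rcases lt_abs.1 h1 with h5 | h5
  · refine ⟨⌊s⌋ + 1, ?_⟩
    push_cast
    rw [abs_le]
    constructor <;> linarith
  · refine ⟨⌊s⌋, ?_⟩
    rw [abs_le]
    constructor <;> linarith

/-- The complementary cutoff lives near the half-integers, where the staircase shifted by `1 / 2` is
flat. -/
theorem exists_int_of_tooth_ne_one {s : ℝ} (h : 1 - tooth s ≠ 0) :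
    ∃ k : ℤ, |s + 1 / 2 - k| ≤ 3 / 10 := by
  have h1 : |Int.fract s - 1 / 2| < 3 / 10 := by
    by_contra! hc
    refine h ?_
    rw [tooth, min_eq_left (by linarith), max_eq_right zero_le_one, sub_self]
  have h2 := Int.self_sub_floor s
  rw [abs_lt] at h1
  refine ⟨⌊s⌋ + 1, ?_⟩
  push_cast
  rw [abs_le]
  constructor <;> linarith

/-- The constants fit together: `3 / 10 + 1 / 10 = 2 / 5`, the half-width of a flat part. -/
theorem stair_eq_stair {s s' : ℝ} (h : |s - s'| ≤ 1 / 10) {k : ℤ} (hk : |s' - k| ≤ 3 / 10) :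
    stair s = stair s' := by
  rw [stair_eq (k := k), stair_eq (k := k)]
  · linarith
  · have := abs_sub_le s s' k
    linarith

end Staircase

/-! ### Commutator estimate for slowly varying phases. -/

section Commutator

variable {X : Type*} [MetricSpace X] [LocallyCompactSpace X]
  {H : Type*} [NormedAddCommGroup H] [InnerProductSpace ℂ H] [CompleteSpace H]

/-- The bounded continuous function `exp(i θ)`. -/
def expI {X : Type*} [TopologicalSpace X] (θ : C(X, ℝ)) : X →ᵇ ℂ :=
  BoundedContinuousFunction.ofNormedAddCommGroup
    (fun x => Complex.exp (Complex.I * (θ x : ℂ))) (by fun_prop) 1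
    (fun x => by rw [mul_comm, Complex.norm_exp_ofReal_mul_I])

theorem expI_apply {X : Type*} [TopologicalSpace X] (θ : C(X, ℝ)) (x : X) :
    expI θ x = Complex.exp (Complex.I * (θ x : ℂ)) := rfl

theorem norm_exp_I_sub_le (a b : ℝ) :
    ‖Complex.exp (Complex.I * a) - Complex.exp (Complex.I * b)‖ ≤ |a - b| := by
  have h : Complex.exp (Complex.I * a) - Complex.exp (Complex.I * b)
      = Complex.exp (Complex.I * b) * (Complex.exp (Complex.I * ((a - b : ℝ) : ℂ)) - 1) := by
    rw [mul_sub, ← Complex.exp_add, mul_one]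
    congr 2
    push_cast
    ring
  rw [h, norm_mul, mul_comm Complex.I (b : ℂ), Complex.norm_exp_ofReal_mul_I, one_mul]
  exact (Real.norm_exp_I_mul_ofReal_sub_one_le).trans (le_of_eq (Real.norm_eq_abs _))

theorem norm_expI_sub_le {X : Type*} [TopologicalSpace X] {θ θ' : C(X, ℝ)} {C : ℝ} (hC : 0 ≤ C)
    (h : ∀ x, |θ x - θ' x| ≤ C) : ‖expI θ - expI θ'‖ ≤ C :=
  (BoundedContinuousFunction.norm_le hC).2 fun x => (norm_exp_I_sub_le _ _).trans (h x)

/-- After multiplication by `P`, the commutator with `g` vanishes, so `e` may be replaced by the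
small difference `e - g`. -/
theorem norm_commutator_mul_le {ρ : C₀(X, ℂ) →⋆ₙₐ[ℂ] (H →L[ℂ] H)} (hρ : Nondegenerate ρ)
    {T : H →L[ℂ] H} {R R' : ℝ} (hRR : R < R') (hT : ∀ p ∈ supp ρ T, dist p.1 p.2 ≤ R)
    {e g P : X →ᵇ ℂ} (hP : ‖P‖ ≤ 1) {δ : ℝ} (heg : ‖e - g‖ ≤ δ)
    (hgP : ∀ x y, dist x y ≤ R' → P y ≠ 0 → g x = g y) :
    ‖(multiplierExtension ρ hρ e * T - T * multiplierExtension ρ hρ e)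
      * multiplierExtension ρ hρ P‖ ≤ 2 * δ * ‖T‖ := by
  have h := multiplier_commute_of_supp hρ hRR hT hgP
  have h1 : (multiplierExtension ρ hρ e * T - T * multiplierExtension ρ hρ e)
      * multiplierExtension ρ hρ P
      = (multiplierExtension ρ hρ (e - g) * T - T * multiplierExtension ρ hρ (e - g))
      * multiplierExtension ρ hρ P := by
    rw [← sub_eq_zero] at h ⊢
    rw [← h, map_sub]
    noncomm_ring
  have h2 : ‖multiplierExtension ρ hρ (e - g)‖ ≤ δ := (norm_multiplierExtension_le ρ hρ _).trans heg
  have h3 : ‖multiplierExtension ρ hρ P‖ ≤ 1 := (norm_multiplierExtension_le ρ hρ _).trans hP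
  have h4 : ‖multiplierExtension ρ hρ (e - g) * T - T * multiplierExtension ρ hρ (e - g)‖
      ≤ δ * ‖T‖ + ‖T‖ * δ :=
    (norm_sub_le _ _).trans (add_le_add
      ((norm_mul_le _ _).trans (mul_le_mul_of_nonneg_right h2 (norm_nonneg _)))
      ((norm_mul_le _ _).trans (mul_le_mul_of_nonneg_left h2 (norm_nonneg _))))
  rw [h1]
  calc _ ≤ _ := norm_mul_le _ _
    _ ≤ ‖multiplierExtension ρ hρ (e - g) * T - T * multiplierExtension ρ hρ (e - g)‖ * 1 :=
      mul_le_mul_of_nonneg_left h3 (norm_nonneg _)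
    _ ≤ _ := by linarith

/-- An operator of finite propagation almost commutes with `exp(i θ)` if `θ` varies slowly. -/
theorem norm_commutator_expI_le {ρ : C₀(X, ℂ) →⋆ₙₐ[ℂ] (H →L[ℂ] H)} (hρ : Nondegenerate ρ)
    {T : H →L[ℂ] H} {R R' : ℝ} (hRR : R < R') (hT : ∀ p ∈ supp ρ T, dist p.1 p.2 ≤ R)
    (θ : C(X, ℝ)) {r : ℝ} (hr : 0 < r) (hθ : ∀ x y, dist x y ≤ R' → |θ x - θ y| ≤ r) :
    ‖multiplierExtension ρ hρ (expI θ) * T - T * multiplierExtension ρ hρ (expI θ)‖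
      ≤ 60 * r * ‖T‖ := by
  have hr10 : 0 < 10 * r := by positivity
  -- The rescaling turns variation `r` into `1 / 10`, the slack in `stair_eq_stair`.
  let s : C(X, ℝ) := ⟨fun x => θ x / (10 * r), by fun_prop⟩
  have hs : ∀ x, θ x = 10 * r * s x := fun x => by
    change θ x = 10 * r * (θ x / (10 * r))
    field_simp
  have hss : ∀ x y, dist x y ≤ R' → |s x - s y| ≤ 1 / 10 := fun x y hxy => by
    have h := hθ x y hxy
    rw [hs, hs, ← mul_sub, abs_mul, abs_of_pos hr10] at h
    by_contra! hc
    nlinarith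
  let w₀ : C(X, ℝ) := ⟨fun x => 10 * r * stair (s x),
    continuous_const.mul (continuous_stair.comp s.continuous)⟩
  let w₁ : C(X, ℝ) := ⟨fun x => 10 * r * stair (s x + 1 / 2),
    continuous_const.mul (continuous_stair.comp (s.continuous.add continuous_const))⟩
  let P₀ : X →ᵇ ℂ := BoundedContinuousFunction.ofNormedAddCommGroup
    (fun x => ((tooth (s x) : ℝ) : ℂ))
    (Complex.continuous_ofReal.comp (continuous_tooth.comp s.continuous)) 1 (fun x => by
      rw [Complex.norm_real, Real.norm_of_nonneg (tooth_nonneg _)]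
      exact tooth_le_one _)
  have hP₀ : ∀ x, P₀ x = ((tooth (s x) : ℝ) : ℂ) := fun x => rfl
  have hP₁ : ∀ x, (1 - P₀) x = ((1 - tooth (s x) : ℝ) : ℂ) := fun x => by
    rw [BoundedContinuousFunction.sub_apply, hP₀]
    simp
  have h₀ := norm_commutator_mul_le hρ hRR hT (e := expI θ) (g := expI w₀) (P := P₀)
    (δ := 10 * r)
    ((BoundedContinuousFunction.norm_le zero_le_one).2 fun x => by
      rw [hP₀, Complex.norm_real, Real.norm_of_nonneg (tooth_nonneg _)]
      exact tooth_le_one _)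
    (norm_expI_sub_le hr10.le fun x => by
      change |θ x - 10 * r * stair (s x)| ≤ _
      rw [hs, ← mul_sub, abs_mul, abs_of_pos hr10, abs_sub_comm]
      exact mul_le_of_le_one_right hr10.le (abs_stair_sub_le _))
    (fun x y hxy hy => by
      obtain ⟨k, hk⟩ := exists_int_of_tooth_ne_zero (s := s y) fun h => hy (by rw [hP₀, h]; simp)
      have : w₀ x = w₀ y := congrArg (10 * r * ·) (stair_eq_stair (hss x y hxy) hk)
      rw [expI_apply, expI_apply, this])
  have h₁ := norm_commutator_mul_le hρ hRR hT (e := expI θ) (g := expI w₁) (P := 1 - P₀)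
    (δ := 20 * r)
    ((BoundedContinuousFunction.norm_le zero_le_one).2 fun x => by
      rw [hP₁, Complex.norm_real, Real.norm_of_nonneg (by linarith [tooth_le_one (s x)])]
      linarith [tooth_nonneg (s x)])
    (norm_expI_sub_le (by positivity) fun x => by
      change |θ x - 10 * r * stair (s x + 1 / 2)| ≤ _
      rw [hs, ← mul_sub, abs_mul, abs_of_pos hr10]
      have h := abs_le.1 (abs_stair_sub_le (s x + 1 / 2))
      have : |s x - stair (s x + 1 / 2)| ≤ 2 := abs_le.2 ⟨by linarith, by linarith⟩
      nlinarith)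
    (fun x y hxy hy => by
      obtain ⟨k, hk⟩ := exists_int_of_tooth_ne_one (s := s y) fun h => hy (by rw [hP₁, h]; simp)
      have : w₁ x = w₁ y := congrArg (10 * r * ·) (stair_eq_stair
        (by simpa using hss x y hxy) hk)
      rw [expI_apply, expI_apply, this])
  -- The errors `10 * r` and `20 * r` of the two staircases contribute `2 * 10 + 2 * 20 = 60`.
  have hsplit : multiplierExtension ρ hρ (expI θ) * T - T * multiplierExtension ρ hρ (expI θ)
      = (multiplierExtension ρ hρ (expI θ) * T - T * multiplierExtension ρ hρ (expI θ))
        * multiplierExtension ρ hρ P₀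
      + (multiplierExtension ρ hρ (expI θ) * T - T * multiplierExtension ρ hρ (expI θ))
        * multiplierExtension ρ hρ (1 - P₀) := by
    rw [← mul_add, ← map_add, add_sub_cancel, map_one, mul_one]
  rw [hsplit]
  refine (norm_add_le _ _).trans ?_
  linarith

end Commutator

/-! ### The action `Ad σ`; controlled operators are Ad-continuous. -/

section Euclidean

variable {d : ℕ} {X : Set (EuclideanSpace ℝ (Fin d))}
  {H : Type*} [NormedAddCommGroup H] [InnerProductSpace ℂ H] [CompleteSpace H]
  (ρ : C₀(X, ℂ) →⋆ₙₐ[ℂ] (H →L[ℂ] H)) (hρ : Nondegenerate ρ)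

theorem expFun_apply (t : EuclideanSpace ℝ (Fin d)) (x : X) :
    expFun X t x
      = Complex.exp (Complex.I * ((inner ℝ (x : EuclideanSpace ℝ (Fin d)) t : ℝ) : ℂ)) := rfl

theorem sigma_zero : sigma ρ hρ 0 = 1 := by
  have : expFun X 0 = 1 := by
    ext x
    simp [expFun_apply]
  rw [sigma, this, map_one]

theorem sigma_add (s t : EuclideanSpace ℝ (Fin d)) :
    sigma ρ hρ (s + t) = sigma ρ hρ s * sigma ρ hρ t := by
  have : expFun X (s + t) = expFun X s * expFun X t := by
    ext x
    simp [expFun_apply, inner_add_right, mul_add, Complex.exp_add]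
  rw [sigma, this, map_mul, sigma, sigma]

theorem star_sigma (t : EuclideanSpace ℝ (Fin d)) : star (sigma ρ hρ t) = sigma ρ hρ (-t) := by
  have : star (expFun X t) = expFun X (-t) := by
    ext x
    simp [expFun_apply, ← Complex.exp_conj]
  rw [sigma, ← map_star, this, sigma]

theorem sigma_neg_mul_sigma (t : EuclideanSpace ℝ (Fin d)) :
    sigma ρ hρ (-t) * sigma ρ hρ t = 1 := by
  rw [← sigma_add, neg_add_cancel, sigma_zero]

theorem norm_sigma_le (t : EuclideanSpace ℝ (Fin d)) : ‖sigma ρ hρ t‖ ≤ 1 :=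
  (norm_multiplierExtension_le ρ hρ _).trans
    (BoundedContinuousFunction.norm_ofNormedAddCommGroup_le _ zero_le_one _)

theorem norm_sigma_mul_mul_sigma_le (s t : EuclideanSpace ℝ (Fin d)) (S : H →L[ℂ] H) :
    ‖sigma ρ hρ s * S * sigma ρ hρ t‖ ≤ ‖S‖ :=
  calc _ ≤ ‖sigma ρ hρ s‖ * ‖S‖ * ‖sigma ρ hρ t‖ := norm_mul₃_le
    _ ≤ 1 * ‖S‖ * 1 := by gcongr <;> exact norm_sigma_le ρ hρ _
    _ = ‖S‖ := by ring

theorem norm_adSigma_le (t : EuclideanSpace ℝ (Fin d)) (S : H →L[ℂ] H) :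
    ‖adSigma ρ hρ t S‖ ≤ ‖S‖ := norm_sigma_mul_mul_sigma_le ρ hρ _ _ _

theorem adSigma_zero (S : H →L[ℂ] H) : adSigma ρ hρ 0 S = S := by
  simp [adSigma, sigma_zero]

theorem adSigma_add (t : EuclideanSpace ℝ (Fin d)) (S T : H →L[ℂ] H) :
    adSigma ρ hρ t (S + T) = adSigma ρ hρ t S + adSigma ρ hρ t T := by
  simp only [adSigma]
  noncomm_ring

theorem adSigma_sub (t : EuclideanSpace ℝ (Fin d)) (S T : H →L[ℂ] H) :
    adSigma ρ hρ t (S - T) = adSigma ρ hρ t S - adSigma ρ hρ t T := by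
  simp only [adSigma]
  noncomm_ring

theorem adSigma_smul (t : EuclideanSpace ℝ (Fin d)) (z : ℂ) (S : H →L[ℂ] H) :
    adSigma ρ hρ t (z • S) = z • adSigma ρ hρ t S := by
  simp only [adSigma, mul_smul_comm, smul_mul_assoc]

theorem adSigma_mul (t : EuclideanSpace ℝ (Fin d)) (S T : H →L[ℂ] H) :
    adSigma ρ hρ t (S * T) = adSigma ρ hρ t S * adSigma ρ hρ t T := by
  simp only [adSigma]
  calc _ = sigma ρ hρ t * S * 1 * T * sigma ρ hρ (-t) := by noncomm_ring
    _ = _ := by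
      rw [← sigma_neg_mul_sigma ρ hρ t]
      noncomm_ring

theorem adSigma_star (t : EuclideanSpace ℝ (Fin d)) (S : H →L[ℂ] H) :
    adSigma ρ hρ t (star S) = star (adSigma ρ hρ t S) := by
  simp only [adSigma, star_mul, star_sigma, neg_neg, mul_assoc]

/-- This reduces continuity at every `s` to a commutator with `σ_{t - s}`, uniformly in `s`. -/
theorem adSigma_sub_adSigma (s t : EuclideanSpace ℝ (Fin d)) (S : H →L[ℂ] H) :
    adSigma ρ hρ t S - adSigma ρ hρ s S = sigma ρ hρ s *
      (sigma ρ hρ (t - s) * S - S * sigma ρ hρ (t - s)) * sigma ρ hρ (-t) := by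
  have h1 : sigma ρ hρ t = sigma ρ hρ s * sigma ρ hρ (t - s) := by
    rw [← sigma_add, add_sub_cancel]
  have h2 : sigma ρ hρ (-s) = sigma ρ hρ (t - s) * sigma ρ hρ (-t) := by
    rw [← sigma_add]
    congr 1
    abel
  rw [adSigma, adSigma, h1, h2]
  noncomm_ring

/-- Each `Ad σ_t` is a contraction, so norm approximation of `S` is uniform approximation of its
orbit map. -/
theorem isClosed_isAdContinuous : IsClosed {S : H →L[ℂ] H | IsAdContinuous ρ hρ S} := by
  refine isClosed_of_closure_subset fun S hS => ?_
  refine continuous_of_uniform_approx_of_continuous fun u hu => ?_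
  obtain ⟨ε, hε, hu⟩ := Metric.mem_uniformity_dist.1 hu
  obtain ⟨T, hT, hST⟩ := Metric.mem_closure_iff.1 hS ε hε
  refine ⟨fun t => adSigma ρ hρ t T, hT, fun t => hu ?_⟩
  rw [dist_eq_norm, ← adSigma_sub]
  rw [dist_eq_norm] at hST
  exact (norm_adSigma_le ρ hρ t _).trans_lt hST

variable {ρ hρ}

theorem IsControlled.isAdContinuous [LocallyCompactSpace X] {T : H →L[ℂ] H}
    (hT : IsControlled ρ T) : IsAdContinuous ρ hρ T := by
  obtain ⟨R, hR, hT⟩ := hT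
  have hcomm : ∀ t : EuclideanSpace ℝ (Fin d),
      ‖sigma ρ hρ t * T - T * sigma ρ hρ t‖ ≤ 60 * (‖t‖ * (R + 1)) * ‖T‖ := by
    intro t
    rcases eq_or_ne t 0 with rfl | ht
    · simp [sigma_zero]
    let θ : C(X, ℝ) := ⟨fun x => inner ℝ (x : EuclideanSpace ℝ (Fin d)) t, by fun_prop⟩
    have hθ : expFun X t = expI θ := rfl
    rw [sigma, hθ]
    have ht' := norm_pos_iff.2 ht
    refine norm_commutator_expI_le hρ (lt_add_one R) hT θ (by positivity) fun x y hxy => ?_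
    change |inner ℝ (x : EuclideanSpace ℝ (Fin d)) t - inner ℝ (y : EuclideanSpace ℝ (Fin d)) t| ≤ _
    rw [← inner_sub_left]
    refine (abs_real_inner_le_norm _ _).trans ?_
    rw [mul_comm, ← dist_eq_norm]
    exact mul_le_mul_of_nonneg_left hxy (norm_nonneg _)
  have hlip : ∀ s t : EuclideanSpace ℝ (Fin d),
      ‖adSigma ρ hρ t T - adSigma ρ hρ s T‖ ≤ (60 * (R + 1) * ‖T‖) * ‖t - s‖ := by
    intro s t
    rw [adSigma_sub_adSigma]
    refine (norm_sigma_mul_mul_sigma_le ρ hρ _ _ _).trans ((hcomm _).trans (le_of_eq ?_))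
    ring
  refine (LipschitzWith.of_dist_le_mul (K := (60 * (R + 1) * ‖T‖).toNNReal)
    fun t s => ?_).continuous
  rw [dist_eq_norm, dist_eq_norm, Real.coe_toNNReal _ (by positivity)]
  exact hlip s t

end Euclidean

/-! ### Parseval's identity and integrals in closed subspaces. -/

section Parseval

open MeasureTheory FourierTransform

variable {V : Type*} [NormedAddCommGroup V] [InnerProductSpace ℝ V] [FiniteDimensional ℝ V]
  [MeasurableSpace V] [BorelSpace V]
  {E F : Type*} [NormedAddCommGroup E] [NormedSpace ℂ E] [NormedAddCommGroup F] [NormedSpace ℂ F]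

theorem continuous_fourier_of_integrable {f : V → E} (hf : Integrable f) : Continuous (𝓕 f) :=
  VectorFourier.fourierIntegral_continuous Real.continuous_fourierChar
    (L := innerₗ V) continuous_inner hf

/-- Parseval's identity for a sesquilinear form. -/
theorem integral_sesq_fourier_fourier [CompleteSpace E] [CompleteSpace F]
    {f : V → E} {g : V → F} (M : E →L⋆[ℂ] F →L[ℂ] ℂ)
    (hf : Integrable f) (hg : Integrable g) (hgc : Continuous g) (hgF : Integrable (𝓕 g)) :
    ∫ ξ, M (𝓕 f ξ) (𝓕 g ξ) = ∫ x, M (f x) (g x) := by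
  have h : ∫ ξ, M (𝓕 f ξ) (𝓕 g ξ) = ∫ x, M (f x) (𝓕⁻ (𝓕 g) x) := by
    simpa using! VectorFourier.integral_sesq_fourierIntegral_eq_neg_flip M
      (L := innerₗ V) Real.continuous_fourierChar continuous_inner hf hgF
  rw [h, hgc.fourierInv_fourier_eq hg hgF]

end Parseval

section ClosedSubmodule

open MeasureTheory

/-- The quotient map by `p` is continuous and linear and kills the integrand, hence the integral. A
non-integrable `f` has integral `0` by convention. -/
theorem integral_mem_of_isClosed {α : Type*} [MeasurableSpace α] {μ : Measure α} {E : Type*}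
    [NormedAddCommGroup E] [NormedSpace ℂ E] [CompleteSpace E] {p : Submodule ℂ E}
    (hp : IsClosed (p : Set E)) {f : α → E} (hf : ∀ a, f a ∈ p) : ∫ a, f a ∂μ ∈ p := by
  by_cases hfi : Integrable f μ
  · have := hp
    rw [← Submodule.Quotient.mk_eq_zero]
    have h := (p.mkQL).integral_comp_comm hfi
    have h0 : ∀ a, p.mkQL (f a) = 0 := fun a => (Submodule.Quotient.mk_eq_zero p).2 (hf a)
    simp only [h0, integral_zero] at h
    exact h.symm
  · rw [integral_undef hfi]
    exact p.zero_mem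

end ClosedSubmodule

/-! ### Smoothing Ad-continuous operators into controlled ones. -/

section Smoothing

open MeasureTheory FourierTransform

variable {d : ℕ} {X : Set (EuclideanSpace ℝ (Fin d))}
  {H : Type*} [NormedAddCommGroup H] [InnerProductSpace ℂ H] [CompleteSpace H]
  {ρ : C₀(X, ℂ) →⋆ₙₐ[ℂ] (H →L[ℂ] H)} {hρ : Nondegenerate ρ}

/-- Evaluation at `x` on `C₀(X)`. -/
def evalC0 {X : Type*} [TopologicalSpace X] (x : X) : C₀(X, ℂ) →L[ℂ] ℂ :=
  LinearMap.mkContinuous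
    { toFun := fun f => f x
      map_add' := fun _ _ => rfl
      map_smul' := fun _ _ => rfl } 1 fun f => by
    rw [one_mul, ← ZeroAtInftyContinuousMap.norm_toBCF_eq_norm]
    exact f.toBCF.norm_coe_le_norm x

theorem evalC0_apply {X : Type*} [TopologicalSpace X] (x : X) (f : C₀(X, ℂ)) :
    evalC0 x f = f x := rfl

theorem norm_mulC0_le {X : Type*} [TopologicalSpace X] (b : X →ᵇ ℂ) (f : C₀(X, ℂ)) :
    ‖mulC0 b f‖ ≤ ‖b‖ * ‖f‖ := by
  rw [← ZeroAtInftyContinuousMap.norm_toBCF_eq_norm, ← ZeroAtInftyContinuousMap.norm_toBCF_eq_norm]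
  exact norm_mul_le b f.toBCF

theorem norm_expFun_le (t : EuclideanSpace ℝ (Fin d)) : ‖expFun X t‖ ≤ 1 :=
  BoundedContinuousFunction.norm_ofNormedAddCommGroup_le _ zero_le_one _

/-- The phases `exp(i x·t)` are Lipschitz in `t` with constant `‖x‖`, which is bounded on the set
where `f` does not vanish. -/
theorem continuous_mulC0_expFun {f : C₀(X, ℂ)} {M : ℝ}
    (hf : ∀ x : X, f x ≠ 0 → ‖(x : EuclideanSpace ℝ (Fin d))‖ ≤ M) :
    Continuous fun t => mulC0 (expFun X t) f := by
  refine (LipschitzWith.of_dist_le_mul (K := (|M| * ‖f‖).toNNReal) fun t s => ?_).continuous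
  rw [← ZeroAtInftyContinuousMap.dist_toBCF_eq_dist, Real.coe_toNNReal _ (by positivity),
    BoundedContinuousFunction.dist_le (by positivity)]
  intro x
  change dist (expFun X t x * f x) (expFun X s x * f x) ≤ _
  rw [dist_eq_norm, ← sub_mul, norm_mul, expFun_apply, expFun_apply]
  by_cases hx : f x = 0
  · rw [hx, norm_zero, mul_zero]
    positivity
  · have h1 := norm_exp_I_sub_le (inner ℝ (x : EuclideanSpace ℝ (Fin d)) t)
      (inner ℝ (x : EuclideanSpace ℝ (Fin d)) s)
    rw [← inner_sub_right] at h1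
    have h2 := h1.trans (abs_real_inner_le_norm _ _)
    have h3 : ‖f x‖ ≤ ‖f‖ := by
      rw [← ZeroAtInftyContinuousMap.norm_toBCF_eq_norm]
      exact f.toBCF.norm_coe_le_norm x
    calc _ ≤ (|M| * ‖t - s‖) * ‖f‖ := by
          gcongr
          refine h2.trans ?_
          gcongr
          exact (hf x hx).trans (le_abs_self M)
      _ = _ := by rw [dist_eq_norm, mul_right_comm]

/-- The operator-valued integral `∫ |ψ(t)|² Ad σ_{ct}(S) dt`. -/
def smoothing (ρ : C₀(X, ℂ) →⋆ₙₐ[ℂ] (H →L[ℂ] H)) (hρ : Nondegenerate ρ)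
    (ψ : SchwartzMap (EuclideanSpace ℝ (Fin d)) ℂ) (c : ℝ) (S : H →L[ℂ] H) : H →L[ℂ] H :=
  ∫ t, ‖ψ t‖ ^ 2 • adSigma ρ hρ (c • t) S

theorem integrable_norm_sq (ψ : SchwartzMap (EuclideanSpace ℝ (Fin d)) ℂ) :
    Integrable fun t => ‖ψ t‖ ^ 2 := by
  simpa using (ψ.memLp 2).integrable_norm_pow (by norm_num)

theorem integrable_smoothing (ψ : SchwartzMap (EuclideanSpace ℝ (Fin d)) ℂ) (c : ℝ)
    {S : H →L[ℂ] H} (hS : IsAdContinuous ρ hρ S) :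
    Integrable fun t => ‖ψ t‖ ^ 2 • adSigma ρ hρ (c • t) S := by
  refine ((integrable_norm_sq ψ).mul_const ‖S‖).mono' ?_ (.of_forall fun t => ?_)
  · have h : Continuous fun t => adSigma ρ hρ (c • t) S := hS.comp (continuous_const_smul c)
    exact ((ψ.continuous.norm.pow 2).smul h).aestronglyMeasurable
  · rw [norm_smul, Real.norm_of_nonneg (by positivity)]
    gcongr
    exact norm_adSigma_le ρ hρ _ S

/-- Dominated convergence, with Ad-continuity at `0` giving the pointwise limit. The value `c = 0`
is excluded because only `c ≠ 0` will yield controlled operators. -/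
theorem tendsto_smoothing (ψ : SchwartzMap (EuclideanSpace ℝ (Fin d)) ℂ)
    {S : H →L[ℂ] H} (hS : IsAdContinuous ρ hρ S) :
    Filter.Tendsto (fun c : ℝ => smoothing ρ hρ ψ c S) (nhdsWithin 0 {0}ᶜ)
      (nhds ((∫ t, ‖ψ t‖ ^ 2) • S)) := by
  rw [← integral_smul_const]
  refine tendsto_integral_filter_of_dominated_convergence (fun t => ‖ψ t‖ ^ 2 * ‖S‖)
    (.of_forall fun c => (integrable_smoothing ψ c hS).aestronglyMeasurable)
    (.of_forall fun c => .of_forall fun t => ?_) ((integrable_norm_sq ψ).mul_const ‖S‖)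
    (.of_forall fun t => ?_)
  · rw [norm_smul, Real.norm_of_nonneg (by positivity)]
    gcongr
    exact norm_adSigma_le ρ hρ _ S
  · refine Filter.Tendsto.const_smul ?_ _
    have h : Continuous fun c : ℝ => adSigma ρ hρ (c • t) S :=
      hS.comp (continuous_id.smul continuous_const)
    have h0 := h.tendsto 0
    simp only [zero_smul, adSigma_zero] at h0
    exact h0.mono_left nhdsWithin_le_nhds

theorem sigma_rep_apply (f : C₀(X, ℂ)) (t : EuclideanSpace ℝ (Fin d)) (ζ : H) :
    sigma ρ hρ t (ρ f ζ) = ρ (mulC0 (expFun X t) f) ζ :=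
  multiplierExtension_apply ρ hρ _ f ζ

theorem continuous_sigma_rep_apply {f : C₀(X, ℂ)} {M : ℝ}
    (hf : ∀ x : X, f x ≠ 0 → ‖(x : EuclideanSpace ℝ (Fin d))‖ ≤ M) (ζ : H) :
    Continuous fun t => sigma ρ hρ t (ρ f ζ) := by
  simp only [sigma_rep_apply]
  exact ((continuous_rep ρ).comp (continuous_mulC0_expFun hf)).clm_apply continuous_const

theorem IsAdContinuous.smul {S : H →L[ℂ] H} (hS : IsAdContinuous ρ hρ S) (z : ℂ) :
    IsAdContinuous ρ hρ (z • S) := by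
  simp only [IsAdContinuous, adSigma_smul]
  exact (continuous_const_smul z).comp hS

/-- The function `t ↦ ψ(t) σ_{-ct} ξ`. -/
def orbit (ρ : C₀(X, ℂ) →⋆ₙₐ[ℂ] (H →L[ℂ] H)) (hρ : Nondegenerate ρ)
    (ψ : SchwartzMap (EuclideanSpace ℝ (Fin d)) ℂ) (c : ℝ) (ξ : H)
    (t : EuclideanSpace ℝ (Fin d)) : H :=
  ψ t • sigma ρ hρ (-(c • t)) ξ

theorem continuous_orbit (ψ : SchwartzMap (EuclideanSpace ℝ (Fin d)) ℂ) (c : ℝ)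
    {f : C₀(X, ℂ)} {M : ℝ}
    (hf : ∀ x : X, f x ≠ 0 → ‖(x : EuclideanSpace ℝ (Fin d))‖ ≤ M) (ζ : H) :
    Continuous (orbit ρ hρ ψ c (ρ f ζ)) :=
  ψ.continuous.smul ((continuous_sigma_rep_apply hf ζ).comp (continuous_const_smul c).neg)

theorem integrable_orbit (ψ : SchwartzMap (EuclideanSpace ℝ (Fin d)) ℂ) (c : ℝ)
    {f : C₀(X, ℂ)} {M : ℝ}
    (hf : ∀ x : X, f x ≠ 0 → ‖(x : EuclideanSpace ℝ (Fin d))‖ ≤ M) (ζ : H) :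
    Integrable (orbit ρ hρ ψ c (ρ f ζ)) := by
  refine (ψ.integrable.norm.mul_const ‖ρ f ζ‖).mono'
    (continuous_orbit ψ c hf ζ).aestronglyMeasurable (.of_forall fun t => ?_)
  rw [orbit, norm_smul]
  gcongr
  exact (ContinuousLinearMap.le_of_opNorm_le _ (norm_sigma_le ρ hρ _) _).trans (one_mul _).le

/-- The Fourier transform of `t ↦ ψ(t) σ_{-ct} ρ(f) ζ` is `ρ(f_s) ζ` at `s`, where
`f_s(x) = 𝓕ψ(s + c x / 2π) f(x)`; in particular it vanishes at `s` if `f_s = 0`. -/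
theorem fourier_orbit_eq_zero (ψ : SchwartzMap (EuclideanSpace ℝ (Fin d)) ℂ) (c : ℝ)
    {f : C₀(X, ℂ)} {M : ℝ}
    (hf : ∀ x : X, f x ≠ 0 → ‖(x : EuclideanSpace ℝ (Fin d))‖ ≤ M) (ζ : H)
    {s : EuclideanSpace ℝ (Fin d)}
    (hs : ∀ x : X, f x ≠ 0 →
      𝓕 (ψ : EuclideanSpace ℝ (Fin d) → ℂ)
        (s + (c / (2 * Real.pi)) • (x : EuclideanSpace ℝ (Fin d))) = 0) :
    𝓕 (orbit ρ hρ ψ c (ρ f ζ)) s = 0 := by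
  -- The Fourier integrand is lifted to `C₀(X)`, where vanishing of the integral can be tested at
  -- each point.
  let Φ : EuclideanSpace ℝ (Fin d) → C₀(X, ℂ) := fun t =>
    ((Real.fourierChar (-inner ℝ t s) : ℂ) * ψ t) • mulC0 (expFun X (-(c • t))) f
  have hΦc : Continuous Φ := by
    refine Continuous.smul (Continuous.mul ?_ ψ.continuous)
      ((continuous_mulC0_expFun hf).comp (continuous_const_smul c).neg)
    exact continuous_subtype_val.comp (Real.continuous_fourierChar.comp (by fun_prop))
  have hΦ : Integrable Φ := by
    refine (ψ.integrable.norm.mul_const ‖f‖).mono' hΦc.aestronglyMeasurable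
      (.of_forall fun t => ?_)
    rw [norm_smul, norm_mul, Circle.norm_coe, one_mul]
    gcongr
    refine (norm_mulC0_le _ _).trans ?_
    exact mul_le_of_le_one_left (norm_nonneg _) (norm_expFun_le _)
  have hint : ∫ t, Φ t = 0 := by
    ext x
    rw [← evalC0_apply, ← (evalC0 x).integral_comp_comm hΦ]
    by_cases hx : f x = 0
    · simp [Φ, evalC0_apply, hx]
    -- At `x`, the factor `exp(-i c x·t)` shifts the frequency by `c x / 2π`, since
    -- `Real.fourierChar` carries the factor `2π`.
    · have h1 : ∀ t, evalC0 x (Φ t) = Real.fourierChar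
          (-inner ℝ t (s + (c / (2 * Real.pi)) • (x : EuclideanSpace ℝ (Fin d)))) • ψ t * f x := by
        intro t
        simp only [Φ, map_smul, evalC0_apply, mulC0_apply, smul_eq_mul, expFun_apply,
          Real.fourierChar_apply, Circle.smul_def]
        rw [mul_right_comm _ (ψ t), ← mul_assoc, ← Complex.exp_add, mul_right_comm _ (ψ t)]
        congr 3
        rw [inner_add_right, inner_smul_right, inner_neg_right, inner_smul_right,
          real_inner_comm (x : EuclideanSpace ℝ (Fin d)) t]
        push_cast
        have : (Real.pi : ℂ) ≠ 0 := by exact_mod_cast Real.pi_ne_zero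
        field_simp
        ring
      simp only [h1]
      rw [integral_mul_const, ← Real.fourier_eq, hs x hx, zero_mul]
      rfl
  let L : C₀(X, ℂ) →L[ℂ] H :=
    (ContinuousLinearMap.apply ℂ H ζ).comp ⟨(ρ : C₀(X, ℂ) →ₗ[ℂ] (H →L[ℂ] H)), continuous_rep ρ⟩
  have hL := L.integral_comp_comm hΦ
  rw [hint, map_zero] at hL
  rw [Real.fourier_eq, ← hL]
  refine integral_congr_ae (.of_forall fun t => ?_)
  change Real.fourierChar (-inner ℝ t s) • orbit ρ hρ ψ c (ρ f ζ) t = ρ (Φ t) ζ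
  rw [orbit, sigma_rep_apply, Circle.smul_def, smul_smul]
  simp only [Φ, map_smul]
  rfl

theorem integrable_fourier_orbit (ψ : SchwartzMap (EuclideanSpace ℝ (Fin d)) ℂ) {c : ℝ}
    {r : ℝ} (hψ : ∀ s, r < ‖s‖ → 𝓕 (ψ : EuclideanSpace ℝ (Fin d) → ℂ) s = 0)
    {f : C₀(X, ℂ)} {M : ℝ}
    (hf : ∀ x : X, f x ≠ 0 → ‖(x : EuclideanSpace ℝ (Fin d))‖ ≤ M) (ζ : H) :
    Integrable (𝓕 (orbit ρ hρ ψ c (ρ f ζ))) := by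
  refine (continuous_fourier_of_integrable
    (integrable_orbit ψ c hf ζ)).integrable_of_hasCompactSupport ?_
  refine HasCompactSupport.of_support_subset_isCompact
    (isCompact_closedBall (0 : EuclideanSpace ℝ (Fin d)) (r + |c / (2 * Real.pi)| * M))
    fun s hs => ?_
  by_contra hsr
  refine hs (fourier_orbit_eq_zero ψ c hf ζ fun x hx => hψ _ ?_)
  rw [mem_closedBall_zero_iff, not_le] at hsr
  have h1 := norm_sub_norm_le s (-((c / (2 * Real.pi)) • (x : EuclideanSpace ℝ (Fin d))))
  rw [sub_neg_eq_add, norm_neg, norm_smul, Real.norm_eq_abs] at h1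
  have h2 := mul_le_mul_of_nonneg_left (hf x hx) (abs_nonneg (c / (2 * Real.pi)))
  linarith

theorem rep_mul_smoothing_mul_rep_eq_zero (ψ : SchwartzMap (EuclideanSpace ℝ (Fin d)) ℂ) {c : ℝ}
    {r : ℝ} (hψ : ∀ s, r < ‖s‖ → 𝓕 (ψ : EuclideanSpace ℝ (Fin d) → ℂ) s = 0)
    {S : H →L[ℂ] H} (hS : IsAdContinuous ρ hρ S) {f g : C₀(X, ℂ)} {M : ℝ}
    (hf : ∀ x : X, f x ≠ 0 → ‖(x : EuclideanSpace ℝ (Fin d))‖ ≤ M)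
    (hg : ∀ x : X, g x ≠ 0 → ‖(x : EuclideanSpace ℝ (Fin d))‖ ≤ M)
    (hfg : ∀ x y : X, f x ≠ 0 → g y ≠ 0 → 2 * r < |c / (2 * Real.pi)| * dist x y) :
    ρ f * smoothing ρ hρ ψ c S * ρ g = 0 := by
  ext ζ
  refine ext_inner_left ℂ fun η => ?_
  have hf' : ∀ x : X, (star f) x ≠ 0 → ‖(x : EuclideanSpace ℝ (Fin d))‖ ≤ M := fun x hx =>
    hf x fun h => hx (by simp [h])
  let Λ : (H →L[ℂ] H) →L[ℂ] ℂ :=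
    (innerSL ℂ (ρ (star f) η)).comp (ContinuousLinearMap.apply ℂ H (ρ g ζ))
  have hΛ : ∀ A, Λ A = inner ℂ (ρ (star f) η) (A (ρ g ζ)) := fun A => rfl
  have h1 : inner ℂ η ((ρ f * smoothing ρ hρ ψ c S * ρ g) ζ) = Λ (smoothing ρ hρ ψ c S) := by
    rw [hΛ, map_star, ContinuousLinearMap.star_eq_adjoint, ContinuousLinearMap.adjoint_inner_left]
    rfl
  let B : H →L⋆[ℂ] H →L[ℂ] ℂ := ContinuousLinearMap.toSesqForm S
  have hB : ∀ a b, B a b = inner ℂ a (S b) := fun a b => rfl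
  -- Splitting `|ψ|²` as `conj ψ · ψ` and moving `σ_{ct}` to the left vector puts one orbit in each
  -- slot, ready for Parseval.
  have h2 : ∀ t, Λ (‖ψ t‖ ^ 2 • adSigma ρ hρ (c • t) S)
      = B (orbit ρ hρ ψ c (ρ (star f) η) t) (orbit ρ hρ ψ c (ρ g ζ) t) := by
    intro t
    rw [hΛ, hB, orbit, orbit, map_smul, inner_smul_left, inner_smul_right, ← mul_assoc,
      ← star_sigma, ContinuousLinearMap.star_eq_adjoint, ContinuousLinearMap.adjoint_inner_left,
      ← ContinuousLinearMap.star_eq_adjoint, star_sigma, ← Complex.normSq_eq_conj_mul_self,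
      Complex.normSq_eq_norm_sq, smul_apply, inner_smul_right_eq_smul, Complex.real_smul]
    rfl
  rw [h1, smoothing, ← Λ.integral_comp_comm (integrable_smoothing ψ c hS)]
  simp only [h2]
  rw [← integral_sesq_fourier_fourier B (integrable_orbit ψ c hf' η) (integrable_orbit ψ c hg ζ)
    (continuous_orbit ψ c hg ζ) (integrable_fourier_orbit ψ hψ hg ζ)]
  rw [zero_apply, inner_zero_right]
  refine integral_eq_zero_of_ae (.of_forall fun s => ?_)
  -- If both transforms were nonzero at `s`, some `x` and `y` with `f x ≠ 0` and `g y ≠ 0` would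
  -- have `c x / 2π` and `c y / 2π` both within `r` of `-s`, against `hfg`.
  by_cases h3 : ∃ x : X, f x ≠ 0 ∧
      ‖s + (c / (2 * Real.pi)) • (x : EuclideanSpace ℝ (Fin d))‖ ≤ r
  · obtain ⟨x, hx, hxs⟩ := h3
    have h4 : 𝓕 (orbit ρ hρ ψ c (ρ g ζ)) s = 0 := by
      refine fourier_orbit_eq_zero ψ c hg ζ fun y hy => hψ _ ?_
      have h5 := hfg x y hx hy
      have h6 := norm_sub_le (s + (c / (2 * Real.pi)) • (x : EuclideanSpace ℝ (Fin d)))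
        (s + (c / (2 * Real.pi)) • (y : EuclideanSpace ℝ (Fin d)))
      rw [add_sub_add_left_eq_sub, ← smul_sub, norm_smul, Real.norm_eq_abs, ← dist_eq_norm] at h6
      change |c / (2 * Real.pi)| * dist x y ≤ _ at h6
      linarith
    simp [h4]
  · push Not at h3
    have h4 : 𝓕 (orbit ρ hρ ψ c (ρ (star f) η)) s = 0 :=
      fourier_orbit_eq_zero ψ c hf' η fun x hx => hψ _ (h3 x fun h => hx (by simp [h]))
    simp [h4]

theorem isControlled_smoothing (ψ : SchwartzMap (EuclideanSpace ℝ (Fin d)) ℂ) {c : ℝ} (hc : c ≠ 0)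
    {r : ℝ} (hr : 0 ≤ r) (hψ : ∀ s, r < ‖s‖ → 𝓕 (ψ : EuclideanSpace ℝ (Fin d) → ℂ) s = 0)
    {S : H →L[ℂ] H} (hS : IsAdContinuous ρ hρ S) : IsControlled ρ (smoothing ρ hρ ψ c S) := by
  have hk : 0 < |c / (2 * Real.pi)| := abs_pos.2 (div_ne_zero hc (by positivity))
  set k := |c / (2 * Real.pi)| with hk_def
  -- The summand `2` pays for the two unit balls, which also supply the bounded supports.
  refine ⟨2 * r / k + 2, by positivity, ?_⟩
  rintro ⟨x, y⟩ hxy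
  by_contra! hd
  refine hxy ⟨Metric.ball x 1, Metric.ball y 1, Metric.isOpen_ball, Metric.isOpen_ball,
    Metric.mem_ball_self one_pos, Metric.mem_ball_self one_pos, fun f g hf hg => ?_⟩
  have hfx : ∀ a : X, f a ≠ 0 → dist a x < 1 := fun a ha => by
    by_contra h
    exact ha (hf a h)
  have hgy : ∀ a : X, g a ≠ 0 → dist a y < 1 := fun a ha => by
    by_contra h
    exact ha (hg a h)
  have hnorm : ∀ a b : X, dist a b < 1 → ‖(a : EuclideanSpace ℝ (Fin d))‖
      ≤ ‖(b : EuclideanSpace ℝ (Fin d))‖ + 1 := fun a b hab => by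
    have h : ‖(a : EuclideanSpace ℝ (Fin d)) - b‖ < 1 := by rwa [← dist_eq_norm]
    have := norm_sub_norm_le (a : EuclideanSpace ℝ (Fin d)) b
    linarith
  refine rep_mul_smoothing_mul_rep_eq_zero ψ hψ hS
    (M := max (‖(x : EuclideanSpace ℝ (Fin d))‖ + 1) (‖(y : EuclideanSpace ℝ (Fin d))‖ + 1))
    (fun a ha => (hnorm a x (hfx a ha)).trans (le_max_left _ _))
    (fun a ha => (hnorm a y (hgy a ha)).trans (le_max_right _ _)) fun a b ha hb => ?_
  have h1 := dist_triangle4 x a b y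
  have h2 := hfx a ha
  have h3 := hgy b hb
  rw [dist_comm] at h2
  have h4 : 2 * r / k < dist a b := by linarith
  rwa [div_lt_iff₀ hk, mul_comm (dist a b)] at h4

/-- There is a Schwartz function of norm one in `L²` with compactly supported Fourier transform. -/
theorem exists_schwartz_fourier_support (d : ℕ) :
    ∃ (ψ : SchwartzMap (EuclideanSpace ℝ (Fin d)) ℂ) (r : ℝ), 0 ≤ r ∧
      (∀ s, r < ‖s‖ → 𝓕 (ψ : EuclideanSpace ℝ (Fin d) → ℂ) s = 0) ∧
      0 < ∫ t, ‖ψ t‖ ^ 2 := by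
  let b : ContDiffBump (0 : EuclideanSpace ℝ (Fin d)) := ⟨1, 2, one_pos, one_lt_two⟩
  let h : EuclideanSpace ℝ (Fin d) → ℂ := fun x => ((b x : ℝ) : ℂ)
  have hc : HasCompactSupport h := b.hasCompactSupport.comp_left Complex.ofReal_zero
  let h' := hc.toSchwartzMap (Complex.ofRealCLM.contDiff.comp b.contDiff)
  have hF : 𝓕 (𝓕⁻ h') = h' := FourierTransform.fourier_fourierInv_eq h'
  refine ⟨𝓕⁻ h', 2, zero_le_two, fun s hs => ?_, ?_⟩
  · rw [← SchwartzMap.fourier_coe, hF]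
    change ((b s : ℝ) : ℂ) = 0
    rw [b.zero_of_le_dist (by rw [dist_zero_right]; exact hs.le), Complex.ofReal_zero]
  -- By Plancherel the integral is the squared `L²` norm of the bump function.
  · rw [← SchwartzMap.integral_norm_sq_fourier, hF]
    refine Continuous.integral_pos_of_hasCompactSupport_nonneg_nonzero (x := 0)
      (h'.continuous.norm.pow 2) ?_ (fun _ => by positivity) ?_
    · exact (hc.norm.comp_left (g := fun x : ℝ => x ^ 2) (by simp))
    · change ‖((b 0 : ℝ) : ℂ)‖ ^ 2 ≠ 0
      rw [b.one_of_mem_closedBall (Metric.mem_closedBall_self zero_le_one)]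
      simp

/-- Ad-continuous operators are limits of controlled operators that are integrals of their
conjugates under `σ`. -/
theorem IsAdContinuous.mem_closure {S : H →L[ℂ] H} (hS : IsAdContinuous ρ hρ S)
    {p : Submodule ℂ (H →L[ℂ] H)} (hp : IsClosed (p : Set (H →L[ℂ] H)))
    (hSp : ∀ t, adSigma ρ hρ t S ∈ p) :
    S ∈ closure {T : H →L[ℂ] H | T ∈ p ∧ IsControlled ρ T} := by
  obtain ⟨ψ, r, hr, hψ, hpos⟩ := exists_schwartz_fourier_support d
  -- Dividing by `∫ |ψ|²` beforehand makes the limit exactly `S`.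
  have hS' : IsAdContinuous ρ hρ (((∫ t, ‖ψ t‖ ^ 2 : ℝ) : ℂ)⁻¹ • S) := hS.smul _
  have h := tendsto_smoothing ψ hS'
  rw [← Complex.coe_smul, smul_inv_smul₀ (by exact_mod_cast hpos.ne')] at h
  refine mem_closure_of_tendsto h (eventually_nhdsWithin_of_forall fun c hc => ⟨?_, ?_⟩)
  · refine integral_mem_of_isClosed hp fun t => ?_
    rw [adSigma_smul, ← Complex.coe_smul]
    exact p.smul_mem _ (p.smul_mem _ (hSp _))
  · exact isControlled_smoothing ψ hc hr hψ hS'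

end Smoothing

/-! ### Compactness and locally compact operators. -/

section Compact

variable {H : Type*} [NormedAddCommGroup H] [InnerProductSpace ℂ H] [CompleteSpace H]

/-- **Schauder's theorem** on a Hilbert space: the adjoint of a compact operator is compact. -/
theorem isCompactOperator_star {T : H →L[ℂ] H} (hT : IsCompactOperator T) :
    IsCompactOperator ⇑(star T : H →L[ℂ] H) := by
  have hTT : IsCompactOperator (T * star T) := hT.comp_clm (star T)
  have hK := hTT.isCompact_closure_image_closedBall
    (f := ((T * star T : H →L[ℂ] H) : H →ₗ[ℂ] H)) 1
  have hTB : TotallyBounded ((T * star T : H →L[ℂ] H) '' Metric.closedBall (0 : H) 1) :=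
    hK.totallyBounded.subset subset_closure
  change IsCompactOperator ((star T : H →L[ℂ] H) : H →ₗ[ℂ] H)
  rw [isCompactOperator_iff_isCompact_closure_image_closedBall
    ((star T : H →L[ℂ] H) : H →ₗ[ℂ] H) zero_lt_one]
  suffices h : TotallyBounded ((star T : H →L[ℂ] H) '' Metric.closedBall (0 : H) 1) from
    h.closure.isCompact_of_isClosed isClosed_closure
  rw [Metric.totallyBounded_iff]
  intro ε hε
  -- A finite net for `T T*` on the unit ball serves for `T*`, as `‖T* v‖² ≤ ‖T T* v‖ ‖v‖`. With
  -- `‖v‖ ≤ 2`, mesh `ε² / 4` gives at most `ε² / 2`.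
  obtain ⟨u, hu, hufin, ht⟩ := Set.exists_subset_image_finite_and.1
    (Metric.finite_approx_of_totallyBounded hTB (ε ^ 2 / 4) (by positivity))
  refine ⟨(star T : H →L[ℂ] H) '' u, hufin.image _, ?_⟩
  rintro _ ⟨x, hx, rfl⟩
  obtain ⟨_, ⟨y, hy, rfl⟩, hxy⟩ := Set.mem_iUnion₂.1 (ht ⟨x, hx, rfl⟩)
  refine Set.mem_iUnion₂.2 ⟨_, ⟨y, hy, rfl⟩, ?_⟩
  have hy' := hu hy
  rw [mem_closedBall_zero_iff] at hx hy'
  rw [Metric.mem_ball, dist_eq_norm, ← map_sub] at hxy ⊢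
  have h1 : ‖(star T : H →L[ℂ] H) (x - y)‖ ^ 2
      = RCLike.re (inner ℂ ((T * star T) (x - y)) (x - y)) := by
    rw [← inner_self_eq_norm_sq (𝕜 := ℂ)]
    nth_rewrite 2 [ContinuousLinearMap.star_eq_adjoint]
    rw [ContinuousLinearMap.adjoint_inner_right]
    rfl
  have h2 : ‖x - y‖ ≤ 2 := (norm_sub_le _ _).trans (by linarith)
  have h3 : ‖(star T : H →L[ℂ] H) (x - y)‖ ^ 2 ≤ ‖(T * star T) (x - y)‖ * ‖x - y‖ := by
    rw [h1]
    exact re_inner_le_norm _ _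
  have h4 : ‖(star T : H →L[ℂ] H) (x - y)‖ ^ 2 < ε ^ 2 := by
    nlinarith [norm_nonneg ((T * star T) (x - y)), norm_nonneg (x - y)]
  exact lt_of_pow_lt_pow_left₀ 2 hε.le h4

variable {X : Type*} [TopologicalSpace X]

/-- The closed subspace of locally compact operators. -/
def locallyCompactSubmodule (ρ : C₀(X, ℂ) →⋆ₙₐ[ℂ] (H →L[ℂ] H)) : Submodule ℂ (H →L[ℂ] H) where
  carrier := {T | IsLocallyCompact ρ T}
  add_mem' {a b} ha hb f := by
    rw [mul_add, add_mul]
    exact ⟨(ha f).1.add (hb f).1, (ha f).2.add (hb f).2⟩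
  zero_mem' f := by
    rw [mul_zero, zero_mul]
    exact ⟨isCompactOperator_zero, isCompactOperator_zero⟩
  smul_mem' z a ha f := by
    rw [mul_smul_comm, smul_mul_assoc]
    exact ⟨(ha f).1.smul z, (ha f).2.smul z⟩

theorem isClosed_locallyCompactSubmodule (ρ : C₀(X, ℂ) →⋆ₙₐ[ℂ] (H →L[ℂ] H)) :
    IsClosed (locallyCompactSubmodule ρ : Set (H →L[ℂ] H)) := by
  have h : (locallyCompactSubmodule ρ : Set (H →L[ℂ] H))
      = ⋂ f : C₀(X, ℂ), ((fun T => ρ f * T) ⁻¹' {K : H →L[ℂ] H | IsCompactOperator K}) ∩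
        ((fun T => T * ρ f) ⁻¹' {K : H →L[ℂ] H | IsCompactOperator K}) := by
    ext T
    simp only [Set.mem_iInter]
    exact Iff.rfl
  rw [h]
  exact isClosed_iInter fun f =>
    (isClosed_setOfPred_isCompactOperator.preimage (continuous_const.mul continuous_id)).inter
      (isClosed_setOfPred_isCompactOperator.preimage (continuous_id.mul continuous_const))

theorem IsLocallyCompact.mul {ρ : C₀(X, ℂ) →⋆ₙₐ[ℂ] (H →L[ℂ] H)} {S T : H →L[ℂ] H}
    (hS : IsLocallyCompact ρ S) (hT : IsLocallyCompact ρ T) : IsLocallyCompact ρ (S * T) :=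
  fun f => ⟨by rw [← mul_assoc]; exact (hS f).1.comp_clm T,
    by rw [mul_assoc]; exact (hT f).2.clm_comp S⟩

theorem IsLocallyCompact.adjoint {ρ : C₀(X, ℂ) →⋆ₙₐ[ℂ] (H →L[ℂ] H)} {T : H →L[ℂ] H}
    (hT : IsLocallyCompact ρ T) : IsLocallyCompact ρ (star T) := fun f => by
  have h1 := isCompactOperator_star (hT (star f)).2
  have h2 := isCompactOperator_star (hT (star f)).1
  rw [star_mul, ← map_star, star_star] at h1 h2
  exact ⟨h1, h2⟩

end Compact

/-! ### The algebra of locally compact, Ad-continuous operators. -/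

section Euclidean

variable {d : ℕ} {X : Set (EuclideanSpace ℝ (Fin d))}
  {H : Type*} [NormedAddCommGroup H] [InnerProductSpace ℂ H] [CompleteSpace H]
  {ρ : C₀(X, ℂ) →⋆ₙₐ[ℂ] (H →L[ℂ] H)} {hρ : Nondegenerate ρ}

/-- Since `σ_t` commutes with every `ρ f`, the factor `ρ f` can be moved next to `T`. -/
theorem IsLocallyCompact.adSigma {T : H →L[ℂ] H} (hT : IsLocallyCompact ρ T)
    (t : EuclideanSpace ℝ (Fin d)) : IsLocallyCompact ρ (adSigma ρ hρ t T) := fun f => by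
  have h1 : ρ f * sigma ρ hρ t = sigma ρ hρ t * ρ f := by
    rw [sigma, rep_mul_multiplierExtension, multiplierExtension_mul_rep]
  have h2 : sigma ρ hρ (-t) * ρ f = ρ f * sigma ρ hρ (-t) := by
    rw [sigma, rep_mul_multiplierExtension, multiplierExtension_mul_rep]
  constructor
  · have h : ρ f * Roe.adSigma ρ hρ t T = sigma ρ hρ t * (ρ f * T * sigma ρ hρ (-t)) := by
      simp only [Roe.adSigma, ← mul_assoc, h1]
    rw [h]
    exact ((hT f).1.comp_clm (sigma ρ hρ (-t))).clm_comp (sigma ρ hρ t)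
  · have h : Roe.adSigma ρ hρ t T * ρ f = sigma ρ hρ t * (T * ρ f * sigma ρ hρ (-t)) := by
      simp only [Roe.adSigma, mul_assoc, h2]
    rw [h]
    exact ((hT f).2.comp_clm (sigma ρ hρ (-t))).clm_comp (sigma ρ hρ t)

/-- The `C⋆`-algebra of locally compact operators that are continuous with respect to `Ad σ`. -/
def adContinuousLocallyCompact (ρ : C₀(X, ℂ) →⋆ₙₐ[ℂ] (H →L[ℂ] H)) (hρ : Nondegenerate ρ) :
    NonUnitalStarSubalgebra ℂ (H →L[ℂ] H) where
  carrier := {S | IsLocallyCompact ρ S ∧ IsAdContinuous ρ hρ S}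
  add_mem' {a b} ha hb := ⟨(locallyCompactSubmodule ρ).add_mem ha.1 hb.1, by
    simp only [IsAdContinuous, adSigma_add]
    exact ha.2.add hb.2⟩
  zero_mem' := ⟨(locallyCompactSubmodule ρ).zero_mem, by
    simpa [IsAdContinuous, Roe.adSigma] using continuous_const⟩
  smul_mem' z a ha := ⟨(locallyCompactSubmodule ρ).smul_mem z ha.1, ha.2.smul z⟩
  mul_mem' {a b} ha hb := ⟨ha.1.mul hb.1, by
    simp only [IsAdContinuous, adSigma_mul]
    exact ha.2.mul hb.2⟩
  star_mem' {a} ha := ⟨ha.1.adjoint, by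
    simp only [IsAdContinuous, adSigma_star]
    exact ha.2.star⟩

theorem isClosed_adContinuousLocallyCompact :
    IsClosed (adContinuousLocallyCompact ρ hρ : Set (H →L[ℂ] H)) :=
  (isClosed_locallyCompactSubmodule ρ).inter (isClosed_isAdContinuous ρ hρ)

end Euclidean

end Roe

end

theorem mainTheorem10 {d : ℕ} (X : Set (EuclideanSpace ℝ (Fin d))) (hX : IsClosed X)
    {H : Type*} [NormedAddCommGroup H] [InnerProductSpace ℂ H] [CompleteSpace H]
    (ρ : C₀(X, ℂ) →⋆ₙₐ[ℂ] (H →L[ℂ] H)) (hρ : Roe.Nondegenerate ρ) :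
    (∀ S : H →L[ℂ] H,
      S ∈ closure {T : H →L[ℂ] H | Roe.IsControlled ρ T} ↔ Roe.IsAdContinuous ρ hρ S) ∧
    ∃ A : NonUnitalStarSubalgebra ℂ (H →L[ℂ] H),
      IsClosed (A : Set (H →L[ℂ] H)) ∧
      (A : Set (H →L[ℂ] H)) = Roe.roeAlgebra ρ ∧
      (A : Set (H →L[ℂ] H)) =
        {S : H →L[ℂ] H | Roe.IsLocallyCompact ρ S ∧ Roe.IsAdContinuous ρ hρ S} := by
  -- Local compactness lets operators be detected by their supports, on which the commutator
  -- estimate rests.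
  have : LocallyCompactSpace X := hX.locallyCompactSpace
  refine ⟨fun S => ⟨fun hS => ?_, fun hS => ?_⟩, Roe.adContinuousLocallyCompact ρ hρ,
    Roe.isClosed_adContinuousLocallyCompact, Set.Subset.antisymm (fun S hS => ?_) ?_, rfl⟩
  · exact closure_minimal (fun T hT => Roe.IsControlled.isAdContinuous hT)
      (Roe.isClosed_isAdContinuous ρ hρ) hS
  · exact closure_mono (fun T hT => hT.2)
      -- With `p = ⊤` no side condition is imposed on the approximants; the Roe algebra case below
      -- takes the locally compact operators instead.
      (hS.mem_closure (p := ⊤) isClosed_univ fun _ => Submodule.mem_top)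
  · exact hS.2.mem_closure (Roe.isClosed_locallyCompactSubmodule ρ) fun t => hS.1.adSigma t
  · exact closure_minimal (fun T hT => ⟨hT.1, hT.2.isAdContinuous⟩)
      Roe.isClosed_adContinuousLocallyCompact
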